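/- Let $\mathcal E,\mathcal S$ be disjoint finite sets, $r:\mathcal E\to\mathbb R\setminus\{0\}$, $\rho:\mathcal S\to\mathbb R\setminus\{0\}$ reward rates, $A_{\mathcal E\mathcal E},A_{\mathcal S\mathcal S}$ intensity matrices (nonnegative off-diagonal entries, zero row sums), $P=(P_{ij})_{i\in\mathcal E,j\in\mathcal S}$ a stochastic matrix, and $\gamma>0$ with $\gamma\ge |A_{ii}|$ for all $i\in\mathcal E\cup\mathcal S$. Put $B_{\mathcal E\mathcal E}=I+\tfrac1\gamma A_{\mathcal E\mathcal E}$, $B_{\mathcal S\mathcal S}=I+\tfrac1\gamma A_{\mathcal S\mathcal S}$, $B_{\mathcal E\mathcal S}=P$. Let $\theta_0=0$ and let $\theta_1<\theta_2<\cdots$ be the arrival times of a Poisson process of rate $\gamma$. Let $\widetilde J$ be the process on $\mathcal E\cup\mathcal S$ that is constant on each $[\theta_k,\theta_{k+1})$ and, given that the behavioral switch occurs at the $\ell$-th grid point ($\ell\in\mathbb Z$), moves at $\theta_m$ ($m\ge 1$) according to $B_{\mathcal E\mathcal E}$ if $m<\ell$, to $B_{\mathcal E\mathcal S}$ if $m=\ell$,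 and to $B_{\mathcal S\mathcal S}$ if $m>\ell$; it starts in $\mathcal E$ if $\ell\ge1$ and in $\mathcal S$ if $\ell\le 0$. The grid is independent of the switch index and of the sequence of visited states. Let $\widetilde F(t)=\int_0^t \bar r(\widetilde J(s))\,ds$, where $\bar r=r$ on $\mathcal E$ and $\bar r=\rho$ on $\mathcal S$. Ruin is confirmed at $\theta_n$ if $n=\min\{m\ge1:\widetilde F(\theta_m)<0\}$. Let $\mathcal E^\pm=\{i\in\mathcal E:\pm r(i)>0\}$, $\mathcal S^\pm=\{i\in\mathcal S:\pm\rho(i)>0\}$, and let $\Psi^{(\ell,n)}$ be the matrix with rows $i\in\mathcal E^+\cup\mathcal S^+$, columns $j\in\mathcal E^-\cup\mathcal S^-$ and entries $$\psi^{(\ell,n)}_{ij}=\mathbb P\bigl(\text{ruin is confirmed at }\theta_n,\ \widetilde J(\theta_n-)=j \,\big|\, \text{the switch occurs at }\theta_\ell,\ \widetilde J(0)=i\bigr),$$ a row being zero if $i$ is not a possible starting state for $\ell$ (that is, $i\in\mathcal E$ and $\ell\le0$, or $i\in\mathcal S$ and $\ell\ge1$); for the other rows the conditioning event is assumed to have positive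 probability. Define, in block form with respect to $\mathcal E^\pm,\mathcal S^\pm$, $$H_{+-}=\begin{pmatrix}\bigl\{\tfrac1{r(i)+|r(j)|}\bigr\}&\bigl\{\tfrac1{r(i)+|\rho(j)|}\bigr\}\\ 0&\bigl\{\tfrac1{\rho(i)+|\rho(j)|}\bigr\}\end{pmatrix},$$ $R_-=\mathrm{diag}\bigl(|r(j)|_{j\in\mathcal E^-},|\rho(j)|_{j\in\mathcal S^-}\bigr)$, $R_+=\mathrm{diag}\bigl(r(i)_{i\in\mathcal E^+},\rho(i)_{i\in\mathcal S^+}\bigr)$, and $$B_{+-}^{(\ell,2)}=\begin{pmatrix}B_{\mathcal E^+\mathcal E^-}1_{\ell>1}&B_{\mathcal E^+\mathcal S^-}1_{\ell=1}\\0&B_{\mathcal S^+\mathcal S^-}1_{\ell<1}\end{pmatrix},\quad B_{++}^{(\ell,n)}=\begin{pmatrix}B_{\mathcal E^+\mathcal E^+}1_{\ell>1}&B_{\mathcal E^+\mathcal S^+}1_{\ell=1}\\0&B_{\mathcal S^+\mathcal S^+}1_{\ell<1}\end{pmatrix},$$ $$B_{--}^{(\ell,n)}=\begin{pmatrix}B_{\mathcal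 E^-\mathcal E^-}1_{\ell>n-1}&B_{\mathcal E^-\mathcal S^-}1_{\ell=n-1}\\0&B_{\mathcal S^-\mathcal S^-}1_{\ell<n-1}\end{pmatrix},\quad B_{-+}^{(\ell,n,w)}=\begin{pmatrix}B_{\mathcal E^-\mathcal E^+}1_{\ell>w}&B_{\mathcal E^-\mathcal S^+}1_{\ell=w}\\0&B_{\mathcal S^-\mathcal S^+}1_{\ell<w}\end{pmatrix}.$$ Then for all $n\ge0$ and $\ell\in\mathbb Z$, $$\Psi^{(\ell,n)}=Q^{(\ell,n)}R_-,$$ where $Q^{(\ell,0)}=Q^{(\ell,1)}=0$, $Q^{(\ell,2)}=B^{(\ell,2)}_{+-}\odot H_{+-}$, and for $n\ge3$ $$\begin{aligned}Q^{(\ell,n)}&=\bigl(B_{++}^{(\ell,n)}Q^{(\ell-1,n-1)}R_-\bigr)\odot H_{+-}+\sum_{w=2}^{n-2}\bigl(R_+Q^{(\ell,w)}B_{-+}^{(\ell,n,w)}Q^{(\ell-w,n-w)}R_-\bigr)\odot H_{+-}\\&\quad+\bigl(R_+Q^{(\ell,n-1)}B_{--}^{(\ell,n)}\bigr)\odot H_{+-},\end{aligned}$$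 with $\odot$ the entrywise (Hadamard) product. If only some of the conditioning events of possible starting states have positive probability, the identity holds for the rows of those starting states (and for the rows that are zero by convention). -/

import Mathlib

open MeasureTheory ProbabilityTheory Filter Topology
open scoped Matrix

noncomputable section

namespace SwitchedFluid

/-- Parameters of a univariate uniformized fluid process with a behavioral switch: two finite
environments `E` (before the switch) and `S` (after the switch), nonzero reward rates `r`, `ρ`,
intensity matrices `AE`, `AS`, a transition matrix `P` from `E` to `S`, and a uniformization
rate `γ`. -/
structure Params (E S : Type*) [Fintype E] [Fintype S] where
  r : E → ℝ
  ρ : S → ℝ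
  AE : Matrix E E ℝ
  AS : Matrix S S ℝ
  P : Matrix E S ℝ
  γ : ℝ
  r_ne_zero : ∀ i, r i ≠ 0
  ρ_ne_zero : ∀ i, ρ i ≠ 0
  AE_nonneg : ∀ i j, i ≠ j → 0 ≤ AE i j
  AE_row_sum : ∀ i, ∑ j, AE i j = 0
  AS_nonneg : ∀ i j, i ≠ j → 0 ≤ AS i j
  AS_row_sum : ∀ i, ∑ j, AS i j = 0
  P_nonneg : ∀ i j, 0 ≤ P i j
  P_row_sum : ∀ i, ∑ j, P i j = 1
  γ_pos : 0 < γ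
  abs_AE_le : ∀ i, |AE i i| ≤ γ
  abs_AS_le : ∀ i, |AS i i| ≤ γ

section Matrices

variable {E S : Type*} [Fintype E] [Fintype S] [DecidableEq E] [DecidableEq S] (D : Params E S)

/-- The reward rate of a state of `E ∪ S`. -/
def Params.rate : E ⊕ S → ℝ := Sum.elim D.r D.ρ

/-- `E⁺`. -/
abbrev Params.EP : Type _ := {i : E // 0 < D.r i}
/-- `E⁻`. -/
abbrev Params.EM : Type _ := {i : E // D.r i < 0}
/-- `S⁺`. -/
abbrev Params.SP : Type _ := {i : S // 0 < D.ρ i}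
/-- `S⁻`. -/
abbrev Params.SM : Type _ := {i : S // D.ρ i < 0}

/-- `E⁺ ∪ S⁺`. -/
abbrev Params.Up : Type _ := D.EP ⊕ D.SP
/-- `E⁻ ∪ S⁻`. -/
abbrev Params.Down : Type _ := D.EM ⊕ D.SM

/-- An increasing state as a state of `E ∪ S`. -/
def Params.upState (i : D.Up) : E ⊕ S := Sum.map Subtype.val Subtype.val i
/-- A decreasing state as a state of `E ∪ S`. -/
def Params.downState (j : D.Down) : E ⊕ S := Sum.map Subtype.val Subtype.val j

/-- Uniformized transition matrix within `E`. -/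
def Params.BEE : Matrix E E ℝ := 1 + (1 / D.γ) • D.AE
/-- Uniformized transition matrix within `S`. -/
def Params.BSS : Matrix S S ℝ := 1 + (1 / D.γ) • D.AS
/-- Transition matrix from `E` to `S` at the behavioral switch. -/
def Params.BES : Matrix E S ℝ := D.P

/-- Transition matrix of the environment at the `m`-th grid point when the behavioral switch
occurs at the `ℓ`-th grid point: within `E` strictly before the switch, from `E` to `S` at the
switch, within `S` strictly after it. -/
def Params.step (ℓ m : ℤ) : Matrix (E ⊕ S) (E ⊕ S) ℝ :=
  Matrix.fromBlocks
    (if m < ℓ then D.BEE else 0) (if ℓ = m then D.BES else 0)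
    0 (if ℓ < m then D.BSS else 0)

/-- `H₊₋`. -/
def Params.H : Matrix D.Up D.Down ℝ :=
  Matrix.fromBlocks
    (Matrix.of fun i j => 1 / (D.r i.1 + |D.r j.1|))
    (Matrix.of fun i j => 1 / (D.r i.1 + |D.ρ j.1|))
    0
    (Matrix.of fun i j => 1 / (D.ρ i.1 + |D.ρ j.1|))

/-- `R₋`. -/
def Params.RM : Matrix D.Down D.Down ℝ :=
  Matrix.fromBlocks (Matrix.diagonal fun j => |D.r j.1|) 0
    0 (Matrix.diagonal fun j => |D.ρ j.1|)

/-- `R₊`. -/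
def Params.RP : Matrix D.Up D.Up ℝ :=
  Matrix.fromBlocks (Matrix.diagonal fun i => D.r i.1) 0
    0 (Matrix.diagonal fun i => D.ρ i.1)

/-- `B₊₋^{(ℓ,2)}`. -/
def Params.BPM (ℓ : ℤ) : Matrix D.Up D.Down ℝ :=
  Matrix.fromBlocks
    (if ℓ > 1 then D.BEE.submatrix Subtype.val Subtype.val else 0)
    (if ℓ = 1 then D.BES.submatrix Subtype.val Subtype.val else 0)
    0
    (if ℓ < 1 then D.BSS.submatrix Subtype.val Subtype.val else 0)

/-- `B₊₊^{(ℓ,n)}` (it does not depend on `n`). -/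
def Params.BPP (ℓ : ℤ) : Matrix D.Up D.Up ℝ :=
  Matrix.fromBlocks
    (if ℓ > 1 then D.BEE.submatrix Subtype.val Subtype.val else 0)
    (if ℓ = 1 then D.BES.submatrix Subtype.val Subtype.val else 0)
    0
    (if ℓ < 1 then D.BSS.submatrix Subtype.val Subtype.val else 0)

/-- `B₋₋^{(ℓ,n)}`. -/
def Params.BMM (ℓ : ℤ) (n : ℕ) : Matrix D.Down D.Down ℝ :=
  Matrix.fromBlocks
    (if ℓ > (n : ℤ) - 1 then D.BEE.submatrix Subtype.val Subtype.val else 0)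
    (if ℓ = (n : ℤ) - 1 then D.BES.submatrix Subtype.val Subtype.val else 0)
    0
    (if ℓ < (n : ℤ) - 1 then D.BSS.submatrix Subtype.val Subtype.val else 0)

/-- `B₋₊^{(ℓ,n,w)}` (it does not depend on `n`). -/
def Params.BMP (ℓ : ℤ) (w : ℕ) : Matrix D.Down D.Up ℝ :=
  Matrix.fromBlocks
    (if ℓ > (w : ℤ) then D.BEE.submatrix Subtype.val Subtype.val else 0)
    (if ℓ = (w : ℤ) then D.BES.submatrix Subtype.val Subtype.val else 0)
    0
    (if ℓ < (w : ℤ) then D.BSS.submatrix Subtype.val Subtype.val else 0)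

/-- The matrices `Q^{(ℓ,n)}`, by recursion on `n`; in the sum, `k` stands for `w - 2`, so that
`w` runs through `2, …, n - 2`. For `n = 0, 1` the matrix is zero by convention. -/
def Params.Q (ℓ : ℤ) : ℕ → Matrix D.Up D.Down ℝ
  | 0 => 0
  | 1 => 0
  | 2 => D.BPM ℓ ⊙ D.H
  | m + 3 =>
      (D.BPP ℓ * Params.Q (ℓ - 1) (m + 2) * D.RM) ⊙ D.H
      + ∑ k : Fin m,
          (D.RP * Params.Q ℓ (k.1 + 2) * D.BMP ℓ (k.1 + 2)
            * Params.Q (ℓ - ((k.1 + 2 : ℕ) : ℤ)) (m + 1 - k.1) * D.RM) ⊙ D.H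
      + (D.RP * Params.Q ℓ (m + 2) * D.BMM ℓ (m + 3)) ⊙ D.H
  termination_by n => n
  decreasing_by all_goals omega

end Matrices

section Fluid

variable {E S Ω : Type*}

/-- The environmental process at time `t ≥ 0`: the embedded chain `Y` evaluated at the number of
grid points `θ 1, θ 2, …` in `(-∞, t]`. -/
def env (Y : ℕ → Ω → E ⊕ S) (θ : ℕ → Ω → ℝ) (t : ℝ) (ω : Ω) : E ⊕ S :=
  Y {k : ℕ | 1 ≤ k ∧ θ k ω ≤ t}.ncard ω

variable [Fintype E] [Fintype S] (D : Params E S)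

/-- The fluid level at time `t`, the integral of the reward rate along the environment. -/
def level (Y : ℕ → Ω → E ⊕ S) (θ : ℕ → Ω → ℝ) (t : ℝ) (ω : Ω) : ℝ :=
  ∫ s in (0 : ℝ)..t, D.rate (env Y θ s ω)

/-- Ruin is confirmed at `θ n`: `n` is the least index `m ≥ 1` at which the level observed at
`θ m` is negative. -/
def RuinConfirmedAt (Y : ℕ → Ω → E ⊕ S) (θ : ℕ → Ω → ℝ) (n : ℕ) (ω : Ω) : Prop :=
  IsLeast {m : ℕ | 1 ≤ m ∧ level D Y θ (θ m ω) ω < 0} n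

/-- The initial state `x` is possible when the switch occurs at the `ℓ`-th grid point: it lies in
`E` if the switch is still to come, and in `S` if it took place at or before the origin. -/
def Compatible (ℓ : ℤ) (x : E ⊕ S) : Prop :=
  (x.isLeft ∧ 1 ≤ ℓ) ∨ (x.isRight ∧ ℓ ≤ 0)

/-- The univariate uniformized fluid process with an external behavioral switch. `θ 0 = 0` and
`θ 1, θ 2, …` are the arrival times of a Poisson process of rate `γ` (independent exponential
interarrival times), `L` is the index of the grid point at which the switch occurs, and `Y k` is
the state of the environment on `[θ k, θ (k+1))`. Given `L = ℓ`, the sequence `Y` is a Markov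
chain with transition matrix `step ℓ k` at the `k`-th grid point; the grid is independent of
`(L, Y)`. -/
structure IsSwitchedFluid [DecidableEq E] [DecidableEq S]
    [MeasurableSpace E] [MeasurableSpace S] [MeasurableSpace Ω]
    (μ : Measure Ω) (L : Ω → ℤ) (Y : ℕ → Ω → E ⊕ S) (θ : ℕ → Ω → ℝ) : Prop where
  measurable_switch : Measurable L
  measurable_chain : ∀ k, Measurable (Y k)
  measurable_grid : ∀ k, Measurable (θ k)
  grid_zero : ∀ ω, θ 0 ω = 0
  grid_law : ∀ k, μ.map (fun ω => θ (k + 1) ω - θ k ω) = expMeasure D.γ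
  grid_indep : iIndepFun (fun k ω => θ (k + 1) ω - θ k ω) μ
  grid_indep_chain : IndepFun (fun ω k => θ k ω) (fun ω => (L ω, fun k => Y k ω)) μ
  compatible : ∀ᵐ ω ∂μ, Compatible (L ω) (Y 0 ω)
  chain_law : ∀ (ℓ : ℤ) (n : ℕ) (y : ℕ → E ⊕ S),
    μ.real {ω | L ω = ℓ ∧ ∀ k ≤ n, Y k ω = y k} =
      μ.real {ω | L ω = ℓ ∧ Y 0 ω = y 0} *
        ∏ k ∈ Finset.range n, D.step ℓ ((k : ℤ) + 1) (y k) (y (k + 1))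

/-- The conditioning event: the switch occurs at the `ℓ`-th grid point and the environment
starts in `x`. -/
def startEvent (L : Ω → ℤ) (Y : ℕ → Ω → E ⊕ S) (θ : ℕ → Ω → ℝ) (ℓ : ℤ) (x : E ⊕ S) : Set Ω :=
  {ω | L ω = ℓ ∧ env Y θ 0 ω = x}

/-- The first return probability matrix `Ψ^{(ℓ,n)}`: its entry `(i, j)` is the conditional
probability, given that the switch occurs at `θ ℓ` and that the environment starts in `i`, that
ruin is confirmed at `θ n` and that the left limit of the environment at `θ n` is `j`. Mathlib's
conditional measure is zero when the conditioning event is null, so the rows of initial states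
that are not compatible with `ℓ` are zero. -/
def Psi [MeasurableSpace Ω] (μ : Measure Ω) (L : Ω → ℤ) (Y : ℕ → Ω → E ⊕ S) (θ : ℕ → Ω → ℝ)
    (ℓ : ℤ) (n : ℕ) : Matrix D.Up D.Down ℝ :=
  Matrix.of fun i j =>
    (ProbabilityTheory.cond μ (startEvent L Y θ ℓ (D.upState i))).real
      {ω | RuinConfirmedAt D Y θ n ω ∧
        ∀ᶠ t in 𝓝[<] (θ n ω), env Y θ t ω = D.downState j}

end Fluid

end SwitchedFluid

end

/-! The level is piecewise linear on the grid, so ruin confirmed at a grid point is a first passage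
below zero of a walk whose increments are rates times independent exponentials. Let the initial
level `x ≥ 0` vary, and let `u x` be the weight of the trajectories from `i` that exit at the end of
sojourn `n + 1`, in state `j` (`exitFun`). Write `c` for the rates. The derivative of `u` can be
computed in two ways.

Conditioning on the first sojourn gives `u' = (γ / c i) (u - f)`, where `f` is the weight just after
the first jump (`exitStep`). On the other hand, by lack of memory the overshoot at an exit in state
`k` is exponential of rate `γ / |c k|`. Raising `x` by `dx` therefore prevents that exit with
probability `γ dx / |c k|`, after which the trajectory continues from level zero. So exits in `j` at
sojourn `n + 1` are lost at rate `γ / |c j|`, and new ones are gained from prevented earlier exits.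
Equating the two expressions gives `exitFun_riccati`. Its formal proof needs no overshoot law: by
induction on `n`, the difference `e` of the two sides solves `e' = (γ / c i) e`, and it is bounded
on `[0, ∞)` or zero at the origin, hence zero.

At `x = 0` with `c i > 0` the identity becomes a recursion for `u 0`, with coefficient `1 / c i + 1
/ |c j|` on the left. A decreasing state entered at level zero must exit within its own sojourn.
This splits the right side into the `B₊₊`, `B₋₊` and `B₋₋` terms, and `Q_mul_RM_eq_exit` follows.
The switch only shifts indices: the transition matrix at grid point `m` depends on `ℓ - m`, so
restarting after `m` points replaces `ℓ` by `ℓ - m`.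

The link with probability is `measureReal_ruin`: independence of grid and chain factors each
trajectory into its weight times a walk probability, and `sum_pathWeight_mul_pathProb` sums these to
`exitFun`. -/

noncomputable section

namespace SwitchedFluid

/-! ### The relaxation equation and exponential expectations -/

/-- The solution of `u' = κ (u - f)` which is bounded on `[0, ∞)` if `0 < κ`, and which vanishes
at the origin otherwise. -/
def relax (κ : ℝ) (f : ℝ → ℝ) (x : ℝ) : ℝ :=
  Real.exp (κ * x) *
    ((if 0 < κ then ∫ y in Set.Ioi (0 : ℝ), κ * Real.exp (-(κ * y)) * f y else 0)
      - ∫ y in (0 : ℝ)..x, κ * Real.exp (-(κ * y)) * f y)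

lemma hasDerivAt_exp_neg (κ t : ℝ) :
    HasDerivAt (fun t => Real.exp (-(κ * t))) (Real.exp (-(κ * t)) * -κ) t := by
  simpa using ((hasDerivAt_id t).const_mul κ).neg.exp

lemma hasDerivAt_relax {κ : ℝ} {f : ℝ → ℝ} (hf : Continuous f) (x : ℝ) :
    HasDerivAt (relax κ f) (κ * (relax κ f x - f x)) x := by
  have h1 : HasDerivAt (fun x => Real.exp (κ * x)) (Real.exp (κ * x) * κ) x := by
    simpa using ((hasDerivAt_id x).const_mul κ).exp
  have hc : Continuous fun y => κ * Real.exp (-(κ * y)) * f y := by fun_prop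
  have h2 := (hc.integral_hasStrictDerivAt 0 x).hasDerivAt
  have h3 := h1.mul (h2.const_sub
    (if 0 < κ then ∫ y in Set.Ioi (0 : ℝ), κ * Real.exp (-(κ * y)) * f y else 0))
  refine h3.congr_deriv ?_
  have he : Real.exp (κ * x) * Real.exp (-(κ * x)) = 1 := by
    rw [← Real.exp_add]; simp
  simp only [relax]
  linear_combination (- κ * f x) * he

lemma continuous_relax {κ : ℝ} {f : ℝ → ℝ} (hf : Continuous f) : Continuous (relax κ f) :=
  continuous_iff_continuousAt.2 fun x => (hasDerivAt_relax hf x).continuousAt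

lemma relax_zero_of_neg {κ : ℝ} (hκ : κ < 0) (f : ℝ → ℝ) : relax κ f 0 = 0 := by
  simp [relax, hκ.not_gt]

lemma relax_zero (κ x : ℝ) : relax κ (fun _ => 0) x = 0 := by
  simp [relax]

lemma integrableOn_exp_mul_of_bounded {κ C a : ℝ} (hκ : 0 < κ) {f : ℝ → ℝ}
    (hf : AEStronglyMeasurable f) (hC : ∀ y ≥ a, |f y| ≤ C) :
    IntegrableOn (fun y => κ * Real.exp (-(κ * y)) * f y) (Set.Ioi a) := by
  have h1 : IntegrableOn (fun y : ℝ => κ * Real.exp (-(κ * y))) (Set.Ioi a) := by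
    have := (exp_neg_integrableOn_Ioi a hκ).const_mul κ
    simp only [neg_mul] at this
    exact this
  refine Integrable.mul_bdd h1 hf.restrict (c := C) ?_
  filter_upwards [ae_restrict_mem measurableSet_Ioi] with y hy
  exact hC y (le_of_lt hy)

lemma integral_exp_Ioi {κ : ℝ} (hκ : 0 < κ) (a : ℝ) :
    ∫ y in Set.Ioi a, κ * Real.exp (-(κ * y)) = Real.exp (-(κ * a)) := by
  have := integral_exp_mul_Ioi (a := -κ) (by linarith) a
  simp only [neg_mul] at this
  rw [integral_const_mul, this]
  field_simp

/-- For `x ≥ 0`, `relax κ f x` integrates `f` against the density `|κ| exp (κ (x - y))` on `(x, ∞)`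
if `κ > 0` and on `(0, x)` if `κ < 0`. Its mass is `1`, respectively `1 - exp (κ x)`, so bounds are
inherited. -/
lemma abs_relax_le {κ C : ℝ} (hκ : κ ≠ 0) {f : ℝ → ℝ} (hf : Continuous f)
    (hC : ∀ y ≥ 0, |f y| ≤ C) {x : ℝ} (hx : 0 ≤ x) : |relax κ f x| ≤ C := by
  have hC0 : 0 ≤ C := (abs_nonneg _).trans (hC 0 le_rfl)
  have he : Real.exp (κ * x) * Real.exp (-(κ * x)) = 1 := by
    rw [← Real.exp_add]; simp
  rcases hκ.lt_or_gt with h | h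
  · have hb : |∫ y in (0 : ℝ)..x, κ * Real.exp (-(κ * y)) * f y|
        ≤ ∫ y in (0 : ℝ)..x, -κ * Real.exp (-(κ * y)) * C := by
      rw [← Real.norm_eq_abs]
      refine intervalIntegral.norm_integral_le_of_norm_le (μ := volume)
        (g := fun y => -κ * Real.exp (-(κ * y)) * C) hx (ae_of_all _ fun y hy => ?_)
        (Continuous.intervalIntegrable (by fun_prop) _ _)
      rw [Real.norm_eq_abs, abs_mul, abs_mul, abs_of_neg h, abs_of_pos (Real.exp_pos _)]
      exact mul_le_mul_of_nonneg_left (hC y hy.1.le)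
        (mul_nonneg (neg_nonneg.2 h.le) (Real.exp_pos _).le)
    have hi : ∫ y in (0 : ℝ)..x, -κ * Real.exp (-(κ * y)) * C
        = (Real.exp (-(κ * x)) - 1) * C := by
      rw [intervalIntegral.integral_eq_sub_of_hasDerivAt
        (f := fun y => Real.exp (-(κ * y)) * C)]
      · simp; ring
      · intro y _
        refine ((hasDerivAt_exp_neg κ y).mul_const C).congr_deriv ?_
        ring
      · exact Continuous.intervalIntegrable (by fun_prop) _ _
    rw [hi] at hb
    rw [relax, if_neg h.not_gt, zero_sub, abs_mul, abs_neg, abs_of_pos (Real.exp_pos _)]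
    calc _ ≤ Real.exp (κ * x) * ((Real.exp (-(κ * x)) - 1) * C) := by gcongr
      _ = (1 - Real.exp (κ * x)) * C := by linear_combination C * he
      _ ≤ C := by nlinarith [Real.exp_pos (κ * x)]
  · have hint := integrableOn_exp_mul_of_bounded h hf.aestronglyMeasurable hC
    rw [relax, if_pos h, ← intervalIntegral.integral_interval_add_Ioi hint
      (hint.mono_set (Set.Ioi_subset_Ioi hx)), add_sub_cancel_left, abs_mul,
      abs_of_pos (Real.exp_pos _)]
    have hb : |∫ y in Set.Ioi x, κ * Real.exp (-(κ * y)) * f y|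
        ≤ ∫ y in Set.Ioi x, κ * Real.exp (-(κ * y)) * C := by
      rw [← Real.norm_eq_abs]
      refine norm_integral_le_of_norm_le (g := fun y => κ * Real.exp (-(κ * y)) * C)
        (integrableOn_exp_mul_of_bounded h aestronglyMeasurable_const
          (C := |C|) fun _ _ => le_rfl) ?_
      filter_upwards [ae_restrict_mem measurableSet_Ioi] with y hy
      rw [Real.norm_eq_abs, abs_mul, abs_mul, abs_of_pos h, abs_of_pos (Real.exp_pos _)]
      gcongr
      exact hC y (hx.trans (le_of_lt hy))
    rw [integral_mul_const, integral_exp_Ioi h] at hb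
    calc _ ≤ Real.exp (κ * x) * (Real.exp (-(κ * x)) * C) := by gcongr
      _ = C := by linear_combination C * he

lemma integral_expMeasure {γ : ℝ} (hγ : 0 < γ) (φ : ℝ → ℝ) :
    ∫ t, φ t ∂expMeasure γ = ∫ t in Set.Ioi (0 : ℝ), γ * Real.exp (-(γ * t)) * φ t := by
  have hd : expMeasure γ = volume.withDensity (exponentialPDF γ) := rfl
  have hm : Measurable (exponentialPDF γ) :=
    (measurable_exponentialPDFReal γ).ennreal_ofReal
  rw [hd, integral_withDensity_eq_integral_toReal_smul hm
    (ae_of_all _ fun _ => ENNReal.ofReal_lt_top), ← integral_Ici_eq_integral_Ioi,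
    ← integral_indicator measurableSet_Ici]
  congr 1
  ext t
  rw [exponentialPDF_eq]
  by_cases ht : 0 ≤ t
  · rw [Set.indicator_of_mem (by exact ht), if_pos ht, ENNReal.toReal_ofReal (by positivity),
      smul_eq_mul]
  · rw [Set.indicator_of_notMem (by exact ht), if_neg ht]
    simp

/-- If `u' = (γ / c) (u - f)`, then `u x` is the expectation of `f` at `x` plus `c` times an
exponential variable, restricted to the event that this point is nonnegative. -/
lemma integral_expMeasure_eq_of_hasDerivAt {γ c C C' : ℝ} (hγ : 0 < γ) (hc : c ≠ 0)
    {f u : ℝ → ℝ} (hf : Continuous f) (hC : ∀ y ≥ 0, |f y| ≤ C)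
    (hu : ∀ x, HasDerivAt u (γ / c * (u x - f x)) x) (hC' : ∀ y ≥ 0, |u y| ≤ C')
    (hu0 : c < 0 → u 0 = 0) {x : ℝ} (hx : 0 ≤ x) :
    ∫ t, (if 0 ≤ x + c * t then f (x + c * t) else 0) ∂expMeasure γ = u x := by
  rw [integral_expMeasure hγ]
  -- By the equation for `u` this is an antiderivative of the integrand. Its value at `t = 0` yields
  -- `u x`; the other boundary term vanishes by `hu0` if `c < 0` and by boundedness if `c > 0`.
  have hder : ∀ t, HasDerivAt (fun t => -(Real.exp (-(γ * t)) * u (x + c * t)))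
      (γ * Real.exp (-(γ * t)) * f (x + c * t)) t := by
    intro t
    have h2 : HasDerivAt (fun t => x + c * t) c t := by
      simpa using ((hasDerivAt_id t).const_mul c).const_add x
    have h3 := ((hasDerivAt_exp_neg γ t).mul ((hu (x + c * t)).comp t h2)).neg
    refine h3.congr_deriv ?_
    simp only [Function.comp]
    field_simp
    ring
  rcases hc.lt_or_gt with h | h
  · have hT : 0 ≤ x / (-c) := div_nonneg hx (by linarith)
    have hiff : ∀ t, 0 ≤ x + c * t ↔ t ≤ x / (-c) := by
      intro t
      rw [le_div_iff₀ (by linarith)]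
      constructor <;> intro h <;> linarith
    have hfun : ∀ t, γ * Real.exp (-(γ * t)) * (if 0 ≤ x + c * t then f (x + c * t) else 0)
        = (Set.Iic (x / (-c))).indicator
          (fun t => γ * Real.exp (-(γ * t)) * f (x + c * t)) t := by
      intro t
      rw [Set.indicator_apply]
      simp only [Set.mem_Iic, ← hiff t]
      split_ifs <;> simp
    simp_rw [hfun]
    rw [setIntegral_indicator measurableSet_Iic, Set.Ioi_inter_Iic,
      ← intervalIntegral.integral_of_le hT,
      intervalIntegral.integral_eq_sub_of_hasDerivAt (fun t _ => hder t)
        (Continuous.intervalIntegrable (by fun_prop) _ _)]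
    have : x + c * (x / (-c)) = 0 := by field_simp; ring
    simp [this, hu0 h]
  · have hfun : Set.EqOn
        (fun t => γ * Real.exp (-(γ * t)) * (if 0 ≤ x + c * t then f (x + c * t) else 0))
        (fun t => γ * Real.exp (-(γ * t)) * f (x + c * t)) (Set.Ioi 0) := by
      intro t ht
      have : 0 ≤ x + c * t := by
        have := mul_pos h ht
        linarith
      simp [this]
    rw [setIntegral_congr_fun measurableSet_Ioi hfun]
    have hnn : ∀ y ≥ 0, 0 ≤ x + c * y := fun y hy => by positivity
    rw [integral_Ioi_of_hasDerivAt_of_tendsto' (fun t _ => hder t)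
      (integrableOn_exp_mul_of_bounded hγ (by fun_prop) fun y hy => hC _ (hnn y hy))
      (m := 0)]
    · simp
    · rw [← neg_zero]
      refine Tendsto.neg ?_
      have he : Tendsto (fun t : ℝ => Real.exp (-(γ * t))) atTop (𝓝 0) :=
        Real.tendsto_exp_neg_atTop_nhds_zero.comp (tendsto_id.const_mul_atTop hγ)
      refine squeeze_zero_norm' (a := fun t => Real.exp (-(γ * t)) * C') ?_ ?_
      · filter_upwards [eventually_ge_atTop 0] with t ht
        rw [norm_mul, Real.norm_eq_abs, Real.norm_eq_abs, abs_of_pos (Real.exp_pos _)]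
        gcongr
        exact hC' _ (hnn t ht)
      · simpa using he.mul_const C'

/-- Identifies `relax (γ / c)` as the operator of one sojourn at rate `c`, killed if the sojourn
ends below zero. -/
lemma integral_expMeasure_killed {γ c C : ℝ} (hγ : 0 < γ) (hc : c ≠ 0)
    {f : ℝ → ℝ} (hf : Continuous f) (hC : ∀ y ≥ 0, |f y| ≤ C) {x : ℝ} (hx : 0 ≤ x) :
    ∫ t, (if 0 ≤ x + c * t then f (x + c * t) else 0) ∂expMeasure γ = relax (γ / c) f x :=
  integral_expMeasure_eq_of_hasDerivAt hγ hc hf hC (fun x => hasDerivAt_relax hf x)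
    (fun _ hy => abs_relax_le (div_ne_zero hγ.ne' hc) hf hC hy)
    (fun h => relax_zero_of_neg (div_neg_of_pos_of_neg hγ h) f) hx

/-- A solution of `u' = κ u` on the line is zero if it is bounded on `[0, ∞)` and `0 < κ`, or if
it vanishes at the origin. -/
lemma eq_zero_of_hasDerivAt_mul {κ C : ℝ} {u : ℝ → ℝ} (hu : ∀ x, HasDerivAt u (κ * u x) x)
    (h : (0 < κ ∧ ∀ y ≥ 0, |u y| ≤ C) ∨ u 0 = 0) (x : ℝ) : u x = 0 := by
  have hconst : ∀ x, Real.exp (-(κ * x)) * u x = u 0 := by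
    intro x
    have hd : ∀ x, HasDerivAt (fun x => Real.exp (-(κ * x)) * u x) 0 x := by
      intro x
      refine ((hasDerivAt_exp_neg κ x).mul (hu x)).congr_deriv ?_
      ring
    have := is_const_of_deriv_eq_zero (fun x => (hd x).differentiableAt)
      (fun x => (hd x).deriv) x 0
    simpa using this
  have h0 : u 0 = 0 := by
    rcases h with ⟨hκ, hC⟩ | h
    · have he : Tendsto (fun t : ℝ => Real.exp (-(κ * t)) * C) atTop (𝓝 (0 * C)) :=
        (Real.tendsto_exp_neg_atTop_nhds_zero.comp (tendsto_id.const_mul_atTop hκ)).mul_const C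
      rw [zero_mul] at he
      have : Tendsto (fun t : ℝ => Real.exp (-(κ * t)) * u t) atTop (𝓝 0) := by
        refine squeeze_zero_norm' ?_ he
        filter_upwards [eventually_ge_atTop 0] with t ht
        rw [norm_mul, Real.norm_eq_abs, Real.norm_eq_abs, abs_of_pos (Real.exp_pos _)]
        gcongr
        exact hC _ ht
      simp_rw [hconst] at this
      exact tendsto_nhds_unique tendsto_const_nhds this
    · exact h
  have := hconst x
  rw [h0] at this
  exact (mul_eq_zero.1 this).resolve_left (Real.exp_pos _).ne'

/-! ### Exit weights and the Riccati-type identity -/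

section Exit

variable {V : Type*} [Fintype V] [DecidableEq V] (γ : ℝ) (c : V → ℝ) (K : ℤ → Matrix V V ℝ)

/-- Weight of the trajectories from state `i` which, started at level `x`, fall below zero for the
first time at the end of the `(n + 1)`-st sojourn, the state in that sojourn being `j`. The
transition matrix at the `m`-th grid point is `K (ℓ - m)`. -/
def exitFun : ℕ → ℤ → V → V → ℝ → ℝ
  | 0, _, i, j, x => if i = j ∧ c i < 0 then Real.exp (γ / c i * x) else 0
  | n + 1, ℓ, i, j, x =>
      relax (γ / c i) (fun y => ∑ k, K (ℓ - 1) i k * exitFun n (ℓ - 1) k j y) x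

/-- The weight in `exitFun` seen just after the first grid point. -/
def exitStep : ℕ → ℤ → V → V → ℝ → ℝ
  | 0, _, _, _, _ => 0
  | n + 1, ℓ, i, j, x => ∑ k, K (ℓ - 1) i k * exitFun γ c K n (ℓ - 1) k j x

variable {γ c K}

lemma exitStep_succ (n : ℕ) (ℓ : ℤ) (i j : V) (x : ℝ) :
    exitStep γ c K (n + 1) ℓ i j x = ∑ k, K (ℓ - 1) i k * exitFun γ c K n (ℓ - 1) k j x := rfl

lemma exitFun_succ (n : ℕ) (ℓ : ℤ) (i j : V) :
    exitFun γ c K (n + 1) ℓ i j = relax (γ / c i) (exitStep γ c K (n + 1) ℓ i j) := rfl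

lemma continuous_exitFun (n : ℕ) (ℓ : ℤ) (i j : V) : Continuous (exitFun γ c K n ℓ i j) := by
  induction n generalizing ℓ i j with
  | zero =>
    change Continuous fun x => if i = j ∧ c i < 0 then Real.exp (γ / c i * x) else 0
    split_ifs <;> fun_prop
  | succ n ih =>
    exact continuous_relax (continuous_finsetSum _ fun k _ => (ih (ℓ - 1) k j).const_mul _)

lemma continuous_exitStep (n : ℕ) (ℓ : ℤ) (i j : V) : Continuous (exitStep γ c K n ℓ i j) := by
  cases n with
  | zero => exact continuous_const
  | succ n =>
    exact continuous_finsetSum _ fun k _ => (continuous_exitFun n (ℓ - 1) k j).const_mul _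

lemma exitFun_bounded (hγ : 0 < γ) (hc : ∀ i, c i ≠ 0) (n : ℕ) (ℓ : ℤ) (i j : V) :
    ∃ C, ∀ x ≥ 0, |exitFun γ c K n ℓ i j x| ≤ C := by
  induction n generalizing ℓ i j with
  | zero =>
    refine ⟨1, fun x hx => ?_⟩
    unfold exitFun
    split_ifs with h
    · rw [abs_of_pos (Real.exp_pos _), Real.exp_le_one_iff]
      exact mul_nonpos_of_nonpos_of_nonneg (div_nonpos_of_nonneg_of_nonpos hγ.le h.2.le) hx
    · simp
  | succ n ih =>
    choose C hC using fun k => ih (ℓ - 1) k j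
    refine ⟨∑ k, |K (ℓ - 1) i k| * C k, fun x hx => ?_⟩
    refine abs_relax_le (div_ne_zero hγ.ne' (hc i))
      (continuous_exitStep (γ := γ) (c := c) (K := K) (n + 1) ℓ i j) (fun y hy => ?_) hx
    refine (Finset.abs_sum_le_sum_abs _ _).trans (Finset.sum_le_sum fun k _ => ?_)
    rw [abs_mul]
    exact mul_le_mul_of_nonneg_left (hC k y hy) (abs_nonneg _)

lemma exitStep_bounded (hγ : 0 < γ) (hc : ∀ i, c i ≠ 0) (n : ℕ) (ℓ : ℤ) (i j : V) :
    ∃ C, ∀ x ≥ 0, |exitStep γ c K n ℓ i j x| ≤ C := by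
  cases n with
  | zero => exact ⟨0, fun x _ => by simp [exitStep]⟩
  | succ n =>
    choose C hC using fun k => exitFun_bounded (K := K) hγ hc n (ℓ - 1) k j
    refine ⟨∑ k, |K (ℓ - 1) i k| * C k, fun x hx => ?_⟩
    refine (Finset.abs_sum_le_sum_abs _ _).trans (Finset.sum_le_sum fun k _ => ?_)
    rw [abs_mul]
    exact mul_le_mul_of_nonneg_left (hC k x hx) (abs_nonneg _)

/-- The convention `exitStep 0 = 0` puts the case `n = 0` under the same equation. -/
lemma hasDerivAt_exitFun (n : ℕ) (ℓ : ℤ) (i j : V) (x : ℝ) :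
    HasDerivAt (exitFun γ c K n ℓ i j)
      (γ / c i * (exitFun γ c K n ℓ i j x - exitStep γ c K n ℓ i j x)) x := by
  cases n with
  | zero =>
    by_cases h : i = j ∧ c i < 0
    · have h1 : exitFun γ c K 0 ℓ i j = fun x => Real.exp (γ / c i * x) := by
        ext x; simp only [exitFun, if_pos h]
      have := ((hasDerivAt_id x).const_mul (γ / c i)).exp
      rw [h1]
      refine this.congr_deriv ?_
      simp [exitStep, mul_comm]
    · have h1 : exitFun γ c K 0 ℓ i j = fun x => 0 := by
        ext x; simp only [exitFun, if_neg h]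
      rw [h1]
      refine (hasDerivAt_const x (0 : ℝ)).congr_deriv ?_
      simp [exitStep]
  | succ n => exact hasDerivAt_relax (continuous_exitStep (n + 1) ℓ i j) x

/-- From level zero, a decreasing state is below zero at the end of its first sojourn, so no exit
can come later. -/
lemma exitFun_succ_zero_of_neg (hγ : 0 < γ) {i : V} (hi : c i < 0) (n : ℕ) (ℓ : ℤ) (j : V) :
    exitFun γ c K (n + 1) ℓ i j 0 = 0 :=
  relax_zero_of_neg (div_neg_of_pos_of_neg hγ hi) _

/-- Riccati-type equation for the exit weights: the derivative of the weight in the initial level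
is expressed by the overshoot below that level. -/
lemma exitFun_riccati (hγ : 0 < γ) (hc : ∀ i, c i ≠ 0) (n : ℕ) (ℓ : ℤ) (i j : V) (x : ℝ) :
    (c i)⁻¹ * (exitFun γ c K n ℓ i j x - exitStep γ c K n ℓ i j x) =
      (c j)⁻¹ * exitFun γ c K n ℓ i j x
        - ∑ m ∈ Finset.range n, ∑ k, (c k)⁻¹ * exitFun γ c K m ℓ i k x
            * exitStep γ c K (n - m) (ℓ - m) k j 0 := by
  induction n generalizing ℓ i j x with
  | zero =>
    by_cases h : i = j
    · subst h; simp [exitStep]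
    · simp [exitStep, exitFun, h]
  | succ n ih =>
    set e : ℝ → ℝ := fun x =>
      (c i)⁻¹ * (exitFun γ c K (n + 1) ℓ i j x - exitStep γ c K (n + 1) ℓ i j x)
        - ((c j)⁻¹ * exitFun γ c K (n + 1) ℓ i j x
        - ∑ m ∈ Finset.range (n + 1), ∑ k, (c k)⁻¹ * exitFun γ c K m ℓ i k x
            * exitStep γ c K (n + 1 - m) (ℓ - m) k j 0) with he
    -- The induction hypothesis, averaged over the first jump, gives a derivative of `exitStep` of
    -- the same shape as that of `exitFun`. The term `m = 0` is zero, and dropping it shifts the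
    -- index to match `ℓ - 1`.
    have hstep : ∀ x, HasDerivAt (exitStep γ c K (n + 1) ℓ i j)
        (γ * ((c j)⁻¹ * exitStep γ c K (n + 1) ℓ i j x
          - ∑ m ∈ Finset.range (n + 1), ∑ k, (c k)⁻¹ * exitStep γ c K m ℓ i k x
            * exitStep γ c K (n + 1 - m) (ℓ - m) k j 0)) x := by
      intro x
      have h1 := HasDerivAt.fun_sum (u := Finset.univ) fun k _ =>
        (hasDerivAt_exitFun (γ := γ) (c := c) (K := K) n (ℓ - 1) k j x).const_mul (K (ℓ - 1) i k)
      refine h1.congr_deriv ?_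
      have h2 : ∀ k, γ / c k
          * (exitFun γ c K n (ℓ - 1) k j x - exitStep γ c K n (ℓ - 1) k j x) = _ := fun k => by
        rw [div_eq_mul_inv, mul_assoc, ih (ℓ - 1) k j x]
      simp_rw [h2]
      rw [Finset.sum_range_succ']
      simp only [exitStep, mul_zero, zero_mul, Finset.sum_const_zero, add_zero,
        Nat.add_sub_add_right, Nat.cast_add, Nat.cast_one, sub_add_eq_sub_sub]
      simp only [mul_sub, Finset.sum_sub_distrib, Finset.mul_sum, Finset.sum_mul]
      congr 1
      · exact Finset.sum_congr rfl fun k _ => by ring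
      · rw [Finset.sum_comm]
        refine Finset.sum_congr rfl fun m _ => ?_
        rw [Finset.sum_comm]
        refine Finset.sum_congr rfl fun k _ => Finset.sum_congr rfl fun k' _ => ?_
        rw [sub_right_comm ℓ (m : ℤ) 1]
        ring
    have hder : ∀ x, HasDerivAt e (γ / c i * e x) x := by
      intro x
      have h1 := HasDerivAt.fun_sum (u := Finset.range (n + 1)) fun m _ =>
        HasDerivAt.fun_sum (u := Finset.univ) fun k _ =>
        ((hasDerivAt_exitFun (γ := γ) (c := c) (K := K) m ℓ i k x).const_mul (c k)⁻¹).mul_const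
          (exitStep γ c K (n + 1 - m) (ℓ - m) k j 0)
      have h2 := hasDerivAt_exitFun (γ := γ) (c := c) (K := K) (n + 1) ℓ i j x
      have h3 := ((h2.sub (hstep x)).const_mul (c i)⁻¹).sub ((h2.const_mul (c j)⁻¹).sub h1)
      refine h3.congr_deriv ?_
      have h4 : ∑ m ∈ Finset.range (n + 1), ∑ k, (c k)⁻¹ *
            (γ / c i * (exitFun γ c K m ℓ i k x - exitStep γ c K m ℓ i k x))
            * exitStep γ c K (n + 1 - m) (ℓ - m) k j 0
          = γ / c i * (∑ m ∈ Finset.range (n + 1), ∑ k, (c k)⁻¹ * exitFun γ c K m ℓ i k x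
            * exitStep γ c K (n + 1 - m) (ℓ - m) k j 0
            - ∑ m ∈ Finset.range (n + 1), ∑ k, (c k)⁻¹ * exitStep γ c K m ℓ i k x
            * exitStep γ c K (n + 1 - m) (ℓ - m) k j 0) := by
        rw [← Finset.sum_sub_distrib, Finset.mul_sum]
        refine Finset.sum_congr rfl fun m _ => ?_
        rw [← Finset.sum_sub_distrib, Finset.mul_sum]
        exact Finset.sum_congr rfl fun k _ => by ring
      rw [h4, he]
      ring
    suffices h : e x = 0 from sub_eq_zero.1 h
    rcases (hc i).lt_or_gt with hi | hi
    · refine eq_zero_of_hasDerivAt_mul (C := 0) hder (Or.inr ?_) x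
      rw [he]
      -- At level zero with `c i < 0` only `m = 0`, `k = i` survives in the sum, and it cancels the
      -- `exitStep` term on the left.
      simp only [exitFun_succ_zero_of_neg hγ hi, Finset.sum_range_succ']
      simp [exitFun, hi]
    · choose C hC using fun m k => exitFun_bounded (K := K) hγ hc m ℓ i k
      obtain ⟨C', hC'⟩ := exitStep_bounded (K := K) hγ hc (n + 1) ℓ i j
      refine eq_zero_of_hasDerivAt_mul (C := |(c i)⁻¹| * (C (n + 1) j + C')
        + (|(c j)⁻¹| * C (n + 1) j + ∑ m ∈ Finset.range (n + 1), ∑ k, |(c k)⁻¹| * C m k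
            * |exitStep γ c K (n + 1 - m) (ℓ - m) k j 0|)) hder
        (Or.inl ⟨div_pos hγ hi, fun y hy => ?_⟩) x
      refine (abs_sub _ _).trans (add_le_add ?_ ((abs_sub _ _).trans (add_le_add ?_ ?_)))
      · rw [abs_mul]
        gcongr
        exact (abs_sub _ _).trans (add_le_add (hC _ _ y hy) (hC' y hy))
      · rw [abs_mul]
        gcongr
        exact hC _ _ y hy
      · refine (Finset.abs_sum_le_sum_abs _ _).trans (Finset.sum_le_sum fun m _ => ?_)
        refine (Finset.abs_sum_le_sum_abs _ _).trans (Finset.sum_le_sum fun k _ => ?_)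
        rw [abs_mul, abs_mul]
        gcongr
        exact hC _ _ y hy

end Exit

/-! ### The recursion at level zero -/

section Exit

variable {V : Type*} [Fintype V] [DecidableEq V] {γ : ℝ} {c : V → ℝ} {K : ℤ → Matrix V V ℝ}

lemma exitFun_zero_of_pos {i : V} (hi : 0 < c i) (ℓ : ℤ) (j : V) (x : ℝ) :
    exitFun γ c K 0 ℓ i j x = 0 := by
  simp [exitFun, hi.not_gt]

lemma exitFun_eq_zero_of_pos_right {j : V} (hj : 0 < c j) (n : ℕ) (ℓ : ℤ) (i : V) (x : ℝ) :
    exitFun γ c K n ℓ i j x = 0 := by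
  induction n generalizing ℓ i x with
  | zero =>
    by_cases h : i = j
    · subst h; simp [exitFun, hj.not_gt]
    · simp [exitFun, h]
  | succ n ih =>
    simp only [exitFun, ih, mul_zero, Finset.sum_const_zero]
    exact relax_zero _ _

lemma exitFun_zero_zero {j : V} (hj : c j < 0) (ℓ : ℤ) (i : V) :
    exitFun γ c K 0 ℓ i j 0 = if i = j then 1 else 0 := by
  by_cases h : i = j
  · subst h; simp [exitFun, hj]
  · simp [exitFun, h]

lemma exitFun_one_recursion (hγ : 0 < γ) (hc : ∀ i, c i ≠ 0) {i j : V} (hi : 0 < c i)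
    (hj : c j < 0) (ℓ : ℤ) :
    ((c i)⁻¹ - (c j)⁻¹) * exitFun γ c K 1 ℓ i j 0 = (c i)⁻¹ * K (ℓ - 1) i j := by
  have h := exitFun_riccati (K := K) hγ hc 1 ℓ i j 0
  simp only [exitStep_succ, exitFun_zero_zero hj, Finset.range_one, Finset.sum_singleton,
    exitFun_zero_of_pos hi, mul_ite, mul_one, mul_zero, zero_mul, Finset.sum_const_zero,
    Finset.sum_ite_eq', Finset.mem_univ, if_true] at h
  linear_combination h

/-- In the Riccati sum the term `m = 0` vanishes because `c i > 0`. In the last term, `m = n + 1`,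
the restarted trajectory exits in its next sojourn, which leaves the bare transition probability
into `j`. -/
lemma exitFun_recursion (hγ : 0 < γ) (hc : ∀ i, c i ≠ 0) {i j : V} (hi : 0 < c i)
    (hj : c j < 0) (n : ℕ) (ℓ : ℤ) :
    ((c i)⁻¹ - (c j)⁻¹) * exitFun γ c K (n + 2) ℓ i j 0 =
      (c i)⁻¹ * ∑ l, K (ℓ - 1) i l * exitFun γ c K (n + 1) (ℓ - 1) l j 0
      - ∑ m ∈ Finset.range n, ∑ k, (c k)⁻¹ * exitFun γ c K (m + 1) ℓ i k 0
          * ∑ l, K (ℓ - ((m + 2 : ℕ) : ℤ)) k l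
            * exitFun γ c K (n - m) (ℓ - ((m + 2 : ℕ) : ℤ)) l j 0
      - ∑ k, (c k)⁻¹ * exitFun γ c K (n + 1) ℓ i k 0 * K (ℓ - ((n + 2 : ℕ) : ℤ)) k j := by
  have h := exitFun_riccati (K := K) hγ hc (n + 2) ℓ i j 0
  rw [Finset.sum_range_succ', Finset.sum_range_succ] at h
  simp only [exitFun_zero_of_pos hi, mul_zero, zero_mul, Finset.sum_const_zero, add_zero] at h
  have e1 : n + 2 - (n + 1) = 0 + 1 := by omega
  have e2 : ℓ - ((n + 1 : ℕ) : ℤ) - 1 = ℓ - ((n + 2 : ℕ) : ℤ) := by push_cast; ring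
  rw [e1] at h
  have h1 : ∀ m ∈ Finset.range n, ∑ k, (c k)⁻¹ * exitFun γ c K (m + 1) ℓ i k 0
        * exitStep γ c K (n + 2 - (m + 1)) (ℓ - ((m + 1 : ℕ) : ℤ)) k j 0
      = ∑ k, (c k)⁻¹ * exitFun γ c K (m + 1) ℓ i k 0
          * ∑ l, K (ℓ - ((m + 2 : ℕ) : ℤ)) k l
            * exitFun γ c K (n - m) (ℓ - ((m + 2 : ℕ) : ℤ)) l j 0 := by
    intro m hm
    have hm := Finset.mem_range.1 hm
    have e3 : n + 2 - (m + 1) = (n - m) + 1 := by omega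
    have e4 : ℓ - ((m + 1 : ℕ) : ℤ) - 1 = ℓ - ((m + 2 : ℕ) : ℤ) := by push_cast; ring
    rw [e3]
    simp only [exitStep_succ, e4]
  rw [Finset.sum_congr rfl h1] at h
  simp only [exitStep_succ, exitFun_zero_zero hj, mul_ite, mul_one, mul_zero, Finset.sum_ite_eq',
    Finset.mem_univ, if_true, e2] at h
  linear_combination h

end Exit

/-! ### From exit weights to the matrices `Q` -/

section Matrices

variable {E S : Type*} [Fintype E] [Fintype S] (D : Params E S)

lemma rate_ne_zero (v : E ⊕ S) : D.rate v ≠ 0 := by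
  cases v with
  | inl i => exact D.r_ne_zero i
  | inr i => exact D.ρ_ne_zero i

lemma rate_upState_pos (i : D.Up) : 0 < D.rate (D.upState i) := by
  rcases i with i | i
  · exact i.2
  · exact i.2

lemma rate_downState_neg (j : D.Down) : D.rate (D.downState j) < 0 := by
  rcases j with j | j
  · exact j.2
  · exact j.2

lemma sum_pos_add_sum_neg {ι : Type*} [Fintype ι] {r : ι → ℝ} (hr : ∀ i, r i ≠ 0) (φ : ι → ℝ) :
    ∑ i, φ i = ∑ i : {i // 0 < r i}, φ i + ∑ i : {i // r i < 0}, φ i := by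
  rw [← Finset.sum_subtype (Finset.univ.filter fun i => 0 < r i) (by simp) φ,
    ← Finset.sum_subtype (Finset.univ.filter fun i => r i < 0) (by simp) φ,
    ← Finset.sum_filter_add_sum_filter_not Finset.univ fun i => 0 < r i]
  congr 2
  ext i
  simp only [Finset.mem_filter, Finset.mem_univ, true_and, not_lt]
  exact ⟨fun h => lt_of_le_of_ne h (hr i), le_of_lt⟩

lemma sum_up_add_sum_down (φ : E ⊕ S → ℝ) :
    ∑ v, φ v = ∑ i : D.Up, φ (D.upState i) + ∑ j : D.Down, φ (D.downState j) := by
  simp only [Fintype.sum_sum_type, Params.upState, Params.downState, Sum.map_inl, Sum.map_inr]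
  rw [sum_pos_add_sum_neg D.r_ne_zero fun i => φ (Sum.inl i),
    sum_pos_add_sum_neg D.ρ_ne_zero fun i => φ (Sum.inr i)]
  ring

lemma H_apply (i : D.Up) (j : D.Down) :
    D.H i j = if i.isRight ∧ j.isLeft then 0
      else (D.rate (D.upState i) - D.rate (D.downState j))⁻¹ := by
  rcases i with i | i <;> rcases j with j | j <;>
    simp [Params.H, Params.rate, Params.upState, Params.downState, abs_of_neg j.2, sub_eq_add_neg]

variable [DecidableEq E] [DecidableEq S]

lemma step_eq_step_sub (ℓ m : ℤ) : D.step ℓ m = D.step (ℓ - m) 0 := by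
  simp only [Params.step, sub_pos, sub_eq_zero, sub_neg]

lemma RM_eq : D.RM = Matrix.diagonal fun j => -D.rate (D.downState j) := by
  rw [Params.RM, Matrix.fromBlocks_diagonal]
  congr 1
  ext j
  rcases j with j | j
  · exact abs_of_neg j.2
  · exact abs_of_neg j.2

lemma RP_eq : D.RP = Matrix.diagonal fun i => D.rate (D.upState i) := by
  rw [Params.RP, Matrix.fromBlocks_diagonal]
  congr 1
  ext i
  rcases i with i | i <;> rfl

lemma BPM_apply (ℓ : ℤ) (i : D.Up) (j : D.Down) :
    D.BPM ℓ i j = D.step (ℓ - 1) 0 (D.upState i) (D.downState j) := by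
  rw [← step_eq_step_sub]
  rcases i with i | i <;> rcases j with j | j <;>
    simp only [Params.BPM, Params.step, Params.upState, Params.downState, Sum.map_inl,
      Sum.map_inr, Matrix.fromBlocks_apply₁₁, Matrix.fromBlocks_apply₁₂,
      Matrix.fromBlocks_apply₂₁, Matrix.fromBlocks_apply₂₂, gt_iff_lt] <;>
    first | rfl | (split_ifs <;> rfl)

lemma BPP_apply (ℓ : ℤ) (i j : D.Up) :
    D.BPP ℓ i j = D.step (ℓ - 1) 0 (D.upState i) (D.upState j) := by
  rw [← step_eq_step_sub]
  rcases i with i | i <;> rcases j with j | j <;>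
    simp only [Params.BPP, Params.step, Params.upState, Sum.map_inl,
      Sum.map_inr, Matrix.fromBlocks_apply₁₁, Matrix.fromBlocks_apply₁₂,
      Matrix.fromBlocks_apply₂₁, Matrix.fromBlocks_apply₂₂, gt_iff_lt] <;>
    first | rfl | (split_ifs <;> rfl)

lemma BMM_apply (ℓ : ℤ) (n : ℕ) (i j : D.Down) :
    D.BMM ℓ (n + 1) i j = D.step (ℓ - n) 0 (D.downState i) (D.downState j) := by
  rw [← step_eq_step_sub]
  rcases i with i | i <;> rcases j with j | j <;>
    simp only [Params.BMM, Params.step, Params.downState, Sum.map_inl,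
      Sum.map_inr, Matrix.fromBlocks_apply₁₁, Matrix.fromBlocks_apply₁₂,
      Matrix.fromBlocks_apply₂₁, Matrix.fromBlocks_apply₂₂, gt_iff_lt, Nat.cast_add,
      Nat.cast_one, add_sub_cancel_right] <;>
    first | rfl | (split_ifs <;> rfl)

lemma BMP_apply (ℓ : ℤ) (w : ℕ) (i : D.Down) (j : D.Up) :
    D.BMP ℓ w i j = D.step (ℓ - w) 0 (D.downState i) (D.upState j) := by
  rw [← step_eq_step_sub]
  rcases i with i | i <;> rcases j with j | j <;>
    simp only [Params.BMP, Params.step, Params.downState, Params.upState, Sum.map_inl,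
      Sum.map_inr, Matrix.fromBlocks_apply₁₁, Matrix.fromBlocks_apply₁₂,
      Matrix.fromBlocks_apply₂₁, Matrix.fromBlocks_apply₂₂, gt_iff_lt] <;>
    first | rfl | (split_ifs <;> rfl)

/-- The exit weights of the switched fluid process. -/
abbrev Params.exit (n : ℕ) (ℓ : ℤ) (i j : E ⊕ S) (x : ℝ) : ℝ :=
  exitFun D.γ D.rate (fun k => D.step k 0) n ℓ i j x

/-- There is no way back from `S` to `E`; this accounts for the zero block of `H`. -/
lemma exit_inr_inl (n : ℕ) (ℓ : ℤ) (s : S) (e : E) (x : ℝ) :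
    D.exit n ℓ (Sum.inr s) (Sum.inl e) x = 0 := by
  induction n generalizing ℓ s x with
  | zero => simp [Params.exit, exitFun]
  | succ n ih =>
    have h : ∀ y, ∑ k, D.step (ℓ - 1) 0 (Sum.inr s) k
        * exitFun D.γ D.rate (fun k => D.step k 0) n (ℓ - 1) k (Sum.inl e) y = 0 := by
      intro y
      rw [Fintype.sum_sum_type]
      simp only [ih, mul_zero, Finset.sum_const_zero, add_zero]
      simp [Params.step]
    simp only [Params.exit, exitFun, h]
    exact relax_zero _ _

/-- The first transition matrix has a zero row at an incompatible state, in agreement with the zero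
row of `Psi`. -/
lemma exit_eq_zero_of_not_compatible {ℓ : ℤ} {v : E ⊕ S} (hv : ¬ Compatible ℓ v) (n : ℕ)
    (j : E ⊕ S) (x : ℝ) : D.exit (n + 1) ℓ v j x = 0 := by
  have h : ∀ k, D.step (ℓ - 1) 0 v k = 0 := by
    intro k
    rcases v with v | v
    · have hℓ : ¬ 1 ≤ ℓ := fun h => hv (Or.inl ⟨rfl, h⟩)
      have h1 : ¬ 0 < ℓ - 1 := by omega
      have h2 : ¬ ℓ - 1 = 0 := by omega
      simp only [Params.step, if_neg h1, if_neg h2]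
      rcases k with k | k <;> rfl
    · have hℓ : ¬ ℓ ≤ 0 := fun h => hv (Or.inr ⟨rfl, h⟩)
      have h1 : ¬ ℓ - 1 < 0 := by omega
      simp only [Params.step, if_neg h1]
      rcases k with k | k <;> rfl
  simp only [Params.exit, exitFun, h, zero_mul, Finset.sum_const_zero]
  exact relax_zero _ _

lemma Q_add_three (ℓ : ℤ) (n : ℕ) :
    D.Q ℓ (n + 3) =
      (D.BPP ℓ * D.Q (ℓ - 1) (n + 2) * D.RM) ⊙ D.H
      + ∑ m ∈ Finset.range n,
          (D.RP * D.Q ℓ (m + 2) * D.BMP ℓ (m + 2)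
            * D.Q (ℓ - ((m + 2 : ℕ) : ℤ)) (n + 1 - m) * D.RM) ⊙ D.H
      + (D.RP * D.Q ℓ (n + 2) * D.BMM ℓ (n + 3)) ⊙ D.H := by
  rw [Params.Q, Finset.sum_range]

lemma Q_eq (ℓ : ℤ) {n : ℕ} (hn : 3 ≤ n) :
    D.Q ℓ n =
      (D.BPP ℓ * D.Q (ℓ - 1) (n - 1) * D.RM) ⊙ D.H
      + ∑ w ∈ Finset.Icc 2 (n - 2),
          (D.RP * D.Q ℓ w * D.BMP ℓ w * D.Q (ℓ - (w : ℤ)) (n - w) * D.RM) ⊙ D.H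
      + (D.RP * D.Q ℓ (n - 1) * D.BMM ℓ n) ⊙ D.H := by
  obtain ⟨n, rfl⟩ := Nat.exists_eq_add_of_le' hn
  have hs : ∑ w ∈ Finset.Icc 2 (n + 3 - 2),
        (D.RP * D.Q ℓ w * D.BMP ℓ w * D.Q (ℓ - (w : ℤ)) (n + 3 - w) * D.RM) ⊙ D.H
      = ∑ m ∈ Finset.range n,
          (D.RP * D.Q ℓ (m + 2) * D.BMP ℓ (m + 2)
            * D.Q (ℓ - ((m + 2 : ℕ) : ℤ)) (n + 1 - m) * D.RM) ⊙ D.H := by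
    refine (Finset.sum_bij (fun m _ => m + 2) ?_ ?_ ?_ ?_).symm
    · intro m hm
      simp only [Finset.mem_range, Finset.mem_Icc] at hm ⊢
      omega
    · intro a _ b _ h
      exact Nat.add_right_cancel h
    · intro w hw
      simp only [Finset.mem_Icc] at hw
      exact ⟨w - 2, by simp only [Finset.mem_range]; omega, by omega⟩
    · intro m _
      have : n + 3 - (m + 2) = n + 1 - m := by omega
      rw [this]
  have h1 : n + 3 - 1 = n + 2 := by omega
  rw [Q_add_three, hs, h1]

/-- An exit cannot occur during an increasing sojourn, so only decreasing `k` contribute. For these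
the weight is `Q` times `|rate|`, and dividing by the negative rate leaves `-Q`. -/
lemma sum_rate_inv_mul_exit {n : ℕ} {ℓ : ℤ} {i : D.Up}
    (h : ∀ j, (D.Q ℓ (n + 2) * D.RM) i j = D.exit (n + 1) ℓ (D.upState i) (D.downState j) 0)
    (φ : E ⊕ S → ℝ) :
    ∑ k, (D.rate k)⁻¹ * D.exit (n + 1) ℓ (D.upState i) k 0 * φ k
      = - ∑ k : D.Down, D.Q ℓ (n + 2) i k * φ (D.downState k) := by
  rw [sum_up_add_sum_down D, Finset.sum_eq_zero, zero_add, ← Finset.sum_neg_distrib]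
  · refine Finset.sum_congr rfl fun k _ => ?_
    rw [← h, RM_eq, Matrix.mul_diagonal]
    have := (rate_downState_neg D k).ne
    field_simp
  · intro k _
    have h0 : D.exit (n + 1) ℓ (D.upState i) (D.upState k) 0 = 0 :=
      exitFun_eq_zero_of_pos_right (rate_upState_pos D k) _ _ _ _
    rw [h0, mul_zero, zero_mul]

/-- Decreasing starting states drop out, since from level zero they exit in their first sojourn. -/
lemma sum_mul_exit {n : ℕ} {ℓ : ℤ} {j : D.Down}
    (h : ∀ i, (D.Q ℓ (n + 2) * D.RM) i j = D.exit (n + 1) ℓ (D.upState i) (D.downState j) 0)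
    (φ : E ⊕ S → ℝ) :
    ∑ l, φ l * D.exit (n + 1) ℓ l (D.downState j) 0
      = ∑ l : D.Up, φ (D.upState l) * (D.Q ℓ (n + 2) * D.RM) l j := by
  rw [sum_up_add_sum_down D, add_eq_left.2]
  · simp only [h]
  · refine Finset.sum_eq_zero fun k _ => ?_
    rw [Params.exit, exitFun_succ_zero_of_neg D.γ_pos (rate_downState_neg D k), mul_zero]

/-- Index `n + 2` of `Q` counts sojourns, index `n + 1` of the exit weight counts jumps. The
recursion at level zero is divided by `1 / c i + 1 / |c j|`, with `c` the rates: this creates `H`, a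
factor `c i` (cancelled in the first term, `R₊` in the others) and a factor `|c j|` (the outer
`R₋`). -/
lemma Q_mul_RM_eq_exit (n : ℕ) (ℓ : ℤ) (i : D.Up) (j : D.Down) :
    (D.Q ℓ (n + 2) * D.RM) i j = D.exit (n + 1) ℓ (D.upState i) (D.downState j) 0 := by
  induction n using Nat.strong_induction_on generalizing ℓ i j with
  | _ n ih =>
  -- On this block `H` is zero rather than an inverse rate difference, and both sides vanish.
  by_cases hij : i.isRight ∧ j.isLeft
  · have hz : D.Q ℓ (n + 2) i j = 0 := by
      have hH : D.H i j = 0 := by rw [H_apply, if_pos hij]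
      cases n with
      | zero => simp [Params.Q, hH]
      | succ n => simp [Q_add_three, Matrix.sum_apply, hH]
    rw [RM_eq, Matrix.mul_diagonal, hz, zero_mul]
    rcases i with i | i
    · simp at hij
    · rcases j with j | j
      · exact (exit_inr_inl D _ _ _ _ _).symm
      · simp at hij
  have hi := rate_upState_pos D i
  have hj := rate_downState_neg D j
  have hH : D.H i j = (D.rate (D.upState i) - D.rate (D.downState j))⁻¹ := by
    rw [H_apply, if_neg hij]
  have hne : D.rate (D.upState i) - D.rate (D.downState j) ≠ 0 := by linarith
  cases n with
  | zero =>
    have h := exitFun_one_recursion (K := fun k => D.step k 0) D.γ_pos (rate_ne_zero D) hi hj ℓ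
    rw [RM_eq, Matrix.mul_diagonal, Params.Q, Matrix.hadamard_apply, hH, BPM_apply]
    have hi' := hi.ne'
    have hj' := hj.ne
    field_simp at h ⊢
    linear_combination h
  | succ n =>
    have h := exitFun_recursion (K := fun k => D.step k 0) D.γ_pos (rate_ne_zero D) hi hj n ℓ
    rw [sum_mul_exit D (fun l => ih n (by omega) (ℓ - 1) l j),
      sum_rate_inv_mul_exit D (fun k => ih n (by omega) ℓ i k)] at h
    have h2 : ∀ m ∈ Finset.range n,
        ∑ k, (D.rate k)⁻¹ * D.exit (m + 1) ℓ (D.upState i) k 0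
          * ∑ l, D.step (ℓ - ((m + 2 : ℕ) : ℤ)) 0 k l
            * D.exit (n - m) (ℓ - ((m + 2 : ℕ) : ℤ)) l (D.downState j) 0
        = - (D.Q ℓ (m + 2) * D.BMP ℓ (m + 2)
            * D.Q (ℓ - ((m + 2 : ℕ) : ℤ)) (n + 1 - m) * D.RM) i j := by
      intro m hm
      have hm := Finset.mem_range.1 hm
      obtain ⟨p, hp⟩ : ∃ p, n - m = p + 1 := ⟨n - m - 1, by omega⟩
      have hp' : n + 1 - m = p + 2 := by omega
      rw [sum_rate_inv_mul_exit D (fun k => ih m (by omega) ℓ i k), hp, hp', Matrix.mul_assoc,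
        Matrix.mul_assoc, Matrix.mul_apply]
      congr 1
      refine Finset.sum_congr rfl fun k _ => ?_
      rw [sum_mul_exit D (fun l => ih p (by omega) _ l j), Matrix.mul_apply]
      simp only [BMP_apply]
    rw [Finset.sum_congr rfl h2, Finset.sum_neg_distrib] at h
    have e1 : ∑ l : D.Up, D.step (ℓ - 1) 0 (D.upState i) (D.upState l)
          * (D.Q (ℓ - 1) (n + 2) * D.RM) l j = (D.BPP ℓ * D.Q (ℓ - 1) (n + 2) * D.RM) i j := by
      rw [Matrix.mul_assoc, Matrix.mul_apply]
      simp only [BPP_apply]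
    have e3 : ∑ k : D.Down, D.Q ℓ (n + 2) i k
          * D.step (ℓ - ((n + 2 : ℕ) : ℤ)) 0 (D.downState k) (D.downState j)
        = (D.Q ℓ (n + 2) * D.BMM ℓ (n + 3)) i j := by
      rw [Matrix.mul_apply]
      simp only [BMM_apply]
    rw [e1, e3] at h
    rw [Q_add_three]
    change _ = exitFun D.γ D.rate (fun k => D.step k 0) (n + 2) ℓ _ _ 0
    generalize exitFun D.γ D.rate (fun k => D.step k 0) (n + 2) ℓ (D.upState i)
      (D.downState j) 0 = x at h ⊢
    rw [RM_eq, Matrix.mul_diagonal, ← RM_eq]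
    simp only [Matrix.add_apply, Matrix.sum_apply, Matrix.hadamard_apply, hH, Matrix.mul_assoc]
    simp only [RP_eq, Matrix.diagonal_mul]
    simp only [Matrix.mul_assoc] at h
    rw [← Finset.sum_mul, ← Finset.mul_sum]
    have hi' := hi.ne'
    have hj' := hj.ne
    field_simp at h ⊢
    linear_combination h

end Matrices

/-! ### First passage of a walk with exponential increments -/

/-- The walk with initial level `x` and increments `z` stays nonnegative before its last step,
and is negative after it. -/
def FirstNeg : (n : ℕ) → ℝ → (Fin n → ℝ) → Prop
  | 0, x, _ => x < 0
  | n + 1, x, z => 0 ≤ x ∧ FirstNeg n (x + z 0) fun k => z k.succ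

lemma firstNeg_iff (n : ℕ) (x : ℝ) (z : ℕ → ℝ) :
    FirstNeg n x (fun k => z k) ↔
      (∀ m < n, 0 ≤ x + ∑ k ∈ Finset.range m, z k) ∧ x + ∑ k ∈ Finset.range n, z k < 0 := by
  induction n generalizing x z with
  | zero => simp [FirstNeg]
  | succ n ih =>
    have h := ih (x + z 0) fun k => z (k + 1)
    have hs : ∀ m, x + z 0 + ∑ k ∈ Finset.range m, z (k + 1)
        = x + ∑ k ∈ Finset.range (m + 1), z k := fun m => by
      rw [Finset.sum_range_succ']; ring
    simp only [hs] at h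
    simp only [FirstNeg, Fin.val_zero, Fin.val_succ]
    rw [h, ← and_assoc]
    refine and_congr_left fun _ => ⟨fun h m hm => ?_, fun h => ⟨?_, fun m hm => h _ (by omega)⟩⟩
    · cases m with
      | zero => simpa using h.1
      | succ m => exact h.2 m (by omega)
    · simpa using h 0 (by omega)

lemma measurableSet_firstNeg (n : ℕ) (c : Fin n → ℝ) :
    MeasurableSet {p : ℝ × (Fin n → ℝ) | FirstNeg n p.1 fun k => c k * p.2 k} := by
  induction n with
  | zero => exact measurableSet_lt measurable_fst measurable_const
  | succ n ih =>
    have h : MeasurableSet {p : ℝ × (Fin (n + 1) → ℝ) |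
        FirstNeg n (p.1 + c 0 * p.2 0) fun k => c k.succ * p.2 k.succ} :=
      (ih fun k => c k.succ).preimage
        (f := fun p : ℝ × (Fin (n + 1) → ℝ) => (p.1 + c 0 * p.2 0, fun k : Fin n => p.2 k.succ))
        (by fun_prop)
    exact (measurableSet_le measurable_const measurable_fst).inter h

/-- The probability that the walk started at `x`, whose increments are independent exponential
variables of rate `γ` multiplied by `c`, is negative for the first time after its last step. -/
def pathProb (γ : ℝ) (n : ℕ) (c : Fin n → ℝ) (x : ℝ) : ℝ :=
  (Measure.pi fun _ : Fin n => expMeasure γ).real {t | FirstNeg n x fun k => c k * t k}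

lemma measurable_pathProb {γ : ℝ} (hγ : 0 < γ) (n : ℕ) (c : Fin n → ℝ) :
    Measurable (pathProb γ n c) := by
  have := isProbabilityMeasure_expMeasure hγ
  exact (measurable_measure_prodMk_left (measurableSet_firstNeg n c)).ennreal_toReal

lemma pathProb_nonneg (γ : ℝ) (n : ℕ) (c : Fin n → ℝ) (x : ℝ) : 0 ≤ pathProb γ n c x :=
  measureReal_nonneg

lemma pathProb_le_one {γ : ℝ} (hγ : 0 < γ) (n : ℕ) (c : Fin n → ℝ) (x : ℝ) :
    pathProb γ n c x ≤ 1 := by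
  have := isProbabilityMeasure_expMeasure hγ
  exact measureReal_le_one

lemma pathProb_zero {γ : ℝ} (hγ : 0 < γ) (c : Fin 0 → ℝ) (x : ℝ) :
    pathProb γ 0 c x = if x < 0 then 1 else 0 := by
  have := isProbabilityMeasure_expMeasure hγ
  by_cases h : x < 0 <;> simp [pathProb, FirstNeg, h]

lemma pathProb_succ_of_neg {γ x : ℝ} (n : ℕ) (c : Fin (n + 1) → ℝ) (hx : x < 0) :
    pathProb γ (n + 1) c x = 0 := by
  simp [pathProb, FirstNeg, hx.not_ge]

/-- Fubini after splitting off the first exponential variable. -/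
lemma pathProb_succ {γ x : ℝ} (hγ : 0 < γ) (n : ℕ) (c : Fin (n + 1) → ℝ) (hx : 0 ≤ x) :
    pathProb γ (n + 1) c x
      = ∫ t, pathProb γ n (fun k => c k.succ) (x + c 0 * t) ∂expMeasure γ := by
  have := isProbabilityMeasure_expMeasure hγ
  have hmp := measurePreserving_piFinSuccAbove (fun _ : Fin (n + 1) => expMeasure γ) 0
  have hm : MeasurableSet {q : ℝ × (Fin n → ℝ) |
      FirstNeg n (x + c 0 * q.1) fun k => c k.succ * q.2 k} :=
    (measurableSet_firstNeg n fun k => c k.succ).preimage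
      (f := fun q : ℝ × (Fin n → ℝ) => (x + c 0 * q.1, q.2)) (by fun_prop)
  have hpre : {t : Fin (n + 1) → ℝ | FirstNeg (n + 1) x fun k => c k * t k}
      = MeasurableEquiv.piFinSuccAbove (fun _ => ℝ) 0 ⁻¹' {q : ℝ × (Fin n → ℝ) |
          FirstNeg n (x + c 0 * q.1) fun k => c k.succ * q.2 k} := by
    ext t
    simp only [FirstNeg, hx, true_and, Set.mem_ofPred_eq, Set.mem_preimage]
    rfl
  rw [pathProb, hpre, Measure.real, hmp.measure_preimage hm.nullMeasurableSet,
    Measure.prod_apply hm, ← integral_toReal]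
  · rfl
  · exact (measurable_measure_prodMk_left hm).aemeasurable
  · exact ae_of_all _ fun _ => measure_lt_top _ _

/-! ### Summation over trajectories -/

section Path

variable {V : Type*} (K : ℤ → Matrix V V ℝ)

/-- The product of the transition probabilities along `y`, when the transition matrix at the
`m`-th step is `K (ℓ - m)`. -/
def pathWeight (n : ℕ) (ℓ : ℤ) (y : Fin (n + 1) → V) : ℝ :=
  ∏ k : Fin n, K (ℓ - (((k : ℕ) : ℤ) + 1)) (y k.castSucc) (y k.succ)

lemma pathWeight_cons (n : ℕ) (ℓ : ℤ) (i : V) (y : Fin (n + 1) → V) :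
    pathWeight K (n + 1) ℓ (Fin.cons i y) = K (ℓ - 1) i (y 0) * pathWeight K n (ℓ - 1) y := by
  rw [pathWeight, Fin.prod_univ_succ]
  congr 1
  refine Finset.prod_congr rfl fun k _ => ?_
  simp only [Fin.cons_succ, Fin.val_succ, ← Fin.succ_castSucc]
  congr 1
  push_cast
  ring_nf

variable [Fintype V] [DecidableEq V] {γ : ℝ} {c : V → ℝ}

lemma pathProb_one {γ : ℝ} (hγ : 0 < γ) {c x : ℝ} (hc : c ≠ 0) (hx : 0 ≤ x) :
    pathProb γ 1 (fun _ => c) x = if c < 0 then Real.exp (γ / c * x) else 0 := by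
  have := isProbabilityMeasure_expMeasure hγ
  rw [pathProb_succ hγ 0 _ hx]
  simp only [pathProb_zero hγ]
  -- Passing to the complement turns this into the killed expectation of the constant `1`.
  have h1 : ∀ t : ℝ, (if x + c * t < 0 then (1 : ℝ) else 0)
      = 1 - if 0 ≤ x + c * t then 1 else 0 := by
    intro t
    by_cases h : x + c * t < 0
    · simp [h, h.not_ge]
    · simp [h, not_lt.1 h]
  have hmeas : MeasurableSet {t : ℝ | 0 ≤ x + c * t} :=
    measurableSet_le measurable_const (by fun_prop)
  have hint : Integrable (fun t : ℝ => if 0 ≤ x + c * t then (1 : ℝ) else 0) (expMeasure γ) := by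
    refine Integrable.of_bound
      (Measurable.ite hmeas measurable_const measurable_const).aestronglyMeasurable 1
      (ae_of_all _ fun t => ?_)
    split_ifs <;> simp
  simp_rw [h1]
  rw [integral_sub (integrable_const _) hint, integral_expMeasure_eq_of_hasDerivAt hγ hc
    (f := fun _ => 1) (u := fun x => 1 - if c < 0 then Real.exp (γ / c * x) else 0)
    (C := 1) (C' := 2) continuous_const (by simp) _ _ _ hx]
  · simp
  · intro y
    split_ifs
    · refine ((((hasDerivAt_id y).const_mul (γ / c)).exp).const_sub 1).congr_deriv ?_
      simp only [id]
      ring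
    · simpa using hasDerivAt_const y (1 : ℝ)
  · intro y hy
    split_ifs with h
    · have h1 : Real.exp (γ / c * y) ≤ 1 := Real.exp_le_one_iff.2
        (mul_nonpos_of_nonpos_of_nonneg (div_nonpos_of_nonneg_of_nonpos hγ.le h.le) hy)
      have h2 := Real.exp_pos (γ / c * y)
      rw [abs_of_nonneg] <;> linarith
    · norm_num
  · intro h
    simp [h]

/-- The exit weight is the sum over trajectories of their weight times their exit probability. -/
lemma sum_pathWeight_mul_pathProb (hγ : 0 < γ) (hc : ∀ i, c i ≠ 0) (n : ℕ) (ℓ : ℤ) (i j : V)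
    {x : ℝ} (hx : 0 ≤ x) :
    ∑ y : Fin (n + 1) → V, (if y 0 = i ∧ y (Fin.last n) = j then
      pathWeight K n ℓ y * pathProb γ (n + 1) (fun k => c (y k)) x else 0)
      = exitFun γ c K n ℓ i j x := by
  have := isProbabilityMeasure_expMeasure hγ
  induction n generalizing ℓ i x with
  | zero =>
    rw [← (Equiv.funUnique (Fin 1) V).symm.sum_comp]
    have h : ∀ v, (if (Equiv.funUnique (Fin 1) V).symm v 0 = i
        ∧ (Equiv.funUnique (Fin 1) V).symm v (Fin.last 0) = j then
          pathWeight K 0 ℓ ((Equiv.funUnique (Fin 1) V).symm v)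
            * pathProb γ (0 + 1) (fun k => c ((Equiv.funUnique (Fin 1) V).symm v k)) x else 0)
        = if v = i then (if i = j ∧ c i < 0 then Real.exp (γ / c i * x) else 0) else 0 := by
      intro v
      have hp : pathProb γ (0 + 1) (fun k => c ((Equiv.funUnique (Fin 1) V).symm v k)) x
          = if c v < 0 then Real.exp (γ / c v * x) else 0 := pathProb_one hγ (hc v) hx
      have hv : ∀ k, (Equiv.funUnique (Fin 1) V).symm v k = v := fun _ => rfl
      rw [hp, hv, hv]
      by_cases h1 : v = i
      · subst h1
        by_cases h2 : v = j <;> simp [h2, pathWeight]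
      · simp [h1]
    simp only [h, Finset.sum_ite_eq', Finset.mem_univ, if_true]
    rfl
  | succ n ih =>
    rw [← (Fin.consEquiv fun _ => V).sum_comp, Fintype.sum_prod_type]
    -- Only trajectories with first state `i` count; the remaining states form a trajectory for `ℓ -
    -- 1`, started at the level reached after the first sojourn.
    have h1 : ∀ v, v ≠ i → ∑ y : Fin (n + 1) → V,
        (if (Fin.consEquiv fun _ => V) (v, y) 0 = i
          ∧ (Fin.consEquiv fun _ => V) (v, y) (Fin.last (n + 1)) = j then
          pathWeight K (n + 1) ℓ ((Fin.consEquiv fun _ => V) (v, y))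
            * pathProb γ (n + 1 + 1) (fun k => c ((Fin.consEquiv fun _ => V) (v, y) k)) x
          else 0) = 0 := by
      intro v hv
      refine Finset.sum_eq_zero fun y _ => if_neg fun h => hv ?_
      simpa [Fin.consEquiv] using h.1
    rw [Fintype.sum_eq_single i h1]
    have h2 : ∀ y : Fin (n + 1) → V,
        (if (Fin.consEquiv fun _ => V) (i, y) 0 = i
          ∧ (Fin.consEquiv fun _ => V) (i, y) (Fin.last (n + 1)) = j then
          pathWeight K (n + 1) ℓ ((Fin.consEquiv fun _ => V) (i, y))
            * pathProb γ (n + 1 + 1) (fun k => c ((Fin.consEquiv fun _ => V) (i, y) k)) x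
          else 0)
        = ∫ t, K (ℓ - 1) i (y 0) * (if y (Fin.last n) = j then pathWeight K n (ℓ - 1) y
            * pathProb γ (n + 1) (fun k => c (y k)) (x + c i * t) else 0) ∂expMeasure γ := by
      intro y
      have e0 : (Fin.consEquiv fun _ : Fin (n + 1 + 1) => V) (i, y) = Fin.cons i y := rfl
      rw [e0, pathWeight_cons, pathProb_succ hγ (n + 1) _ hx, ← Fin.succ_last]
      simp only [Fin.cons_zero, Fin.cons_succ, true_and]
      split_ifs with h
      · simp only [integral_const_mul, mul_assoc]
      · simp
    rw [Finset.sum_congr rfl fun y _ => h2 y, ← integral_finsetSum, exitFun_succ]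
    · obtain ⟨C, hC⟩ := exitStep_bounded (K := K) hγ hc (n + 1) ℓ i j
      rw [← integral_expMeasure_killed hγ (hc i)
        (continuous_exitStep (γ := γ) (c := c) (K := K) (n + 1) ℓ i j) hC hx]
      refine integral_congr_ae (ae_of_all _ fun t => ?_)
      dsimp only
      by_cases ht : 0 ≤ x + c i * t
      · rw [if_pos ht, exitStep_succ]
        simp only [← ih (ℓ - 1) _ ht, Finset.mul_sum]
        rw [Finset.sum_comm]
        refine Finset.sum_congr rfl fun y _ => ?_
        rw [Fintype.sum_eq_single (y 0)]
        · simp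
        · intro k hk
          rw [if_neg fun h => hk h.1.symm, mul_zero]
      · rw [if_neg ht]
        refine Finset.sum_eq_zero fun y _ => ?_
        rw [pathProb_succ_of_neg _ _ (not_le.1 ht)]
        simp
    · intro y _
      refine Integrable.const_mul ?_ _
      split_ifs
      · refine Integrable.const_mul ?_ _
        refine Integrable.of_bound (((measurable_pathProb hγ _ _).comp
          (by fun_prop : Measurable fun t => x + c i * t)).aestronglyMeasurable) 1
          (ae_of_all _ fun t => ?_)
        rw [Real.norm_eq_abs, abs_of_nonneg (pathProb_nonneg _ _ _ _)]
        exact pathProb_le_one hγ _ _ _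
      · exact integrable_zero _ _ _

end Path

/-! ### Environment, level and ruin along a strictly increasing grid -/

section Pathwise

variable {E S Ω : Type*} {Y : ℕ → Ω → E ⊕ S} {θ : ℕ → Ω → ℝ} {ω : Ω}

lemma env_eq (hθ : StrictMono fun k => θ k ω) (m : ℕ) {t : ℝ}
    (h1 : θ m ω ≤ t) (h2 : t < θ (m + 1) ω) : env Y θ t ω = Y m ω := by
  have hs : {k : ℕ | 1 ≤ k ∧ θ k ω ≤ t} = ↑(Finset.Icc 1 m) := by
    ext k
    simp only [Set.mem_ofPred_eq, Finset.coe_Icc, Set.mem_Icc]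
    refine and_congr_right fun _ => ⟨fun h => ?_, fun h => (hθ.monotone h).trans h1⟩
    exact Nat.lt_succ_iff.1 (hθ.lt_iff_lt.1 (h.trans_lt h2))
  rw [env, hs, Set.ncard_coe_finset, Nat.card_Icc, Nat.add_sub_cancel]

lemma eventually_env_eq_iff (hθ : StrictMono fun k => θ k ω) (n : ℕ) (v : E ⊕ S) :
    (∀ᶠ t in 𝓝[<] (θ (n + 1) ω), env Y θ t ω = v) ↔ Y n ω = v := by
  have h : ∀ᶠ t in 𝓝[<] (θ (n + 1) ω), env Y θ t ω = Y n ω := by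
    filter_upwards [Ioo_mem_nhdsLT (hθ n.lt_succ_self)] with t ht
    exact env_eq hθ n ht.1.le ht.2
  refine ⟨fun h' => ?_, fun h' => h' ▸ h⟩
  obtain ⟨t, h1, h2⟩ := (h.and h').exists
  exact h1.symm.trans h2

variable [Fintype E] [Fintype S] (D : Params E S)

lemma level_grid (hθ : StrictMono fun k => θ k ω) (h0 : θ 0 ω = 0) (n : ℕ) :
    level D Y θ (θ n ω) ω
      = ∑ k ∈ Finset.range n, D.rate (Y k ω) * (θ (k + 1) ω - θ k ω) := by
  have hle : ∀ k, θ k ω ≤ θ (k + 1) ω := fun k => (hθ k.lt_succ_self).le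
  have heq : ∀ k, Set.EqOn (fun s => D.rate (env Y θ s ω)) (fun _ => D.rate (Y k ω))
      (Set.Ioo (θ k ω) (θ (k + 1) ω)) := fun k s hs => by
    simp only [env_eq hθ k hs.1.le hs.2]
  have hint : ∀ k, IntervalIntegrable (fun s => D.rate (env Y θ s ω)) volume
      (θ k ω) (θ (k + 1) ω) := fun k => by
    rw [intervalIntegrable_iff_integrableOn_Ioo_of_le (hle k),
      integrableOn_congr_fun (heq k) measurableSet_Ioo]
    exact integrableOn_const (by simp)
  rw [level, ← h0, ← intervalIntegral.sum_integral_adjacent_intervals fun k _ => hint k]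
  refine Finset.sum_congr rfl fun k _ => ?_
  rw [intervalIntegral.integral_of_le (hle k), integral_Ioc_eq_integral_Ioo,
    setIntegral_congr_fun measurableSet_Ioo (heq k)]
  simp [Measure.real, hle k, mul_comm]

lemma ruinConfirmedAt_iff (hθ : StrictMono fun k => θ k ω) (h0 : θ 0 ω = 0) (n : ℕ) :
    RuinConfirmedAt D Y θ n ω
      ↔ FirstNeg n 0 fun k => D.rate (Y k ω) * (θ (k + 1) ω - θ k ω) := by
  rw [firstNeg_iff n 0 fun k => D.rate (Y k ω) * (θ (k + 1) ω - θ k ω)]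
  simp only [RuinConfirmedAt, level_grid D hθ h0, IsLeast, lowerBounds, Set.mem_ofPred_eq,
    zero_add]
  constructor
  · rintro ⟨⟨_, h2⟩, h3⟩
    refine ⟨fun m hm => ?_, h2⟩
    by_contra! hneg
    rcases Nat.eq_zero_or_pos m with rfl | hm0
    · simp at hneg
    · exact absurd (h3 ⟨hm0, hneg⟩) (by omega)
  · rintro ⟨h1, h2⟩
    refine ⟨⟨?_, h2⟩, fun m hm => ?_⟩
    · by_contra! hn
      obtain rfl : n = 0 := by omega
      simp at h2
    · by_contra! hlt
      exact absurd hm.2 (h1 m hlt).not_gt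

lemma Psi_zero [MeasurableSpace Ω] (μ : Measure Ω) (L : Ω → ℤ) (ℓ : ℤ) (i : D.Up)
    (j : D.Down) : Psi D μ L Y θ ℓ 0 i j = 0 := by
  have h : {ω | RuinConfirmedAt D Y θ 0 ω ∧
      ∀ᶠ t in 𝓝[<] (θ 0 ω), env Y θ t ω = D.downState j} = ∅ := by
    ext ω
    simp [RuinConfirmedAt, IsLeast]
  simp [Psi, h]

end Pathwise

/-! ### The law of the process -/

section Law

lemma expMeasure_Iic_zero {γ : ℝ} (hγ : 0 < γ) : expMeasure γ (Set.Iic 0) = 0 := by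
  have := isProbabilityMeasure_expMeasure hγ
  rw [← ofReal_cdf, cdf_expMeasure_eq hγ]
  simp

lemma measurableSet_singleton_sum {E S : Type*} [MeasurableSpace E] [DiscreteMeasurableSpace E]
    [MeasurableSpace S] [DiscreteMeasurableSpace S] (v : E ⊕ S) :
    MeasurableSet ({v} : Set (E ⊕ S)) :=
  measurableSet_sum_iff.2 ⟨MeasurableSet.of_discrete, MeasurableSet.of_discrete⟩

variable {E S Ω : Type*} [Fintype E] [Fintype S] [DecidableEq E] [DecidableEq S]
  [MeasurableSpace E] [MeasurableSpace S] [MeasurableSpace Ω] {D : Params E S} {μ : Measure Ω}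
  {L : Ω → ℤ} {Y : ℕ → Ω → E ⊕ S} {θ : ℕ → Ω → ℝ}

lemma IsSwitchedFluid.ae_strictMono (hX : IsSwitchedFluid D μ L Y θ) :
    ∀ᵐ ω ∂μ, StrictMono fun k => θ k ω := by
  have h : ∀ k, ∀ᵐ ω ∂μ, θ k ω < θ (k + 1) ω := by
    intro k
    have hm : Measurable fun ω => θ (k + 1) ω - θ k ω :=
      (hX.measurable_grid (k + 1)).sub (hX.measurable_grid k)
    have h1 : ∀ᵐ t ∂μ.map (fun ω => θ (k + 1) ω - θ k ω), 0 < t := by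
      rw [hX.grid_law k, ae_iff]
      simp only [not_lt]
      exact expMeasure_Iic_zero D.γ_pos
    filter_upwards [ae_of_ae_map hm.aemeasurable h1] with ω hω
    exact sub_pos.1 hω
  filter_upwards [ae_all_iff.2 h] with ω hω
  exact strictMono_nat_of_lt_succ hω

/-- Almost surely the first grid point after the origin is positive, so the environment at time zero
is `Y 0`. -/
lemma IsSwitchedFluid.startEvent_ae_eq (hX : IsSwitchedFluid D μ L Y θ) (ℓ : ℤ) (v : E ⊕ S) :
    startEvent L Y θ ℓ v =ᵐ[μ] {ω | L ω = ℓ ∧ Y 0 ω = v} := by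
  filter_upwards [hX.ae_strictMono] with ω hω
  have h1 : θ 0 ω ≤ 0 := (hX.grid_zero ω).le
  have h2 : 0 < θ (0 + 1) ω := by
    have := hω Nat.zero_lt_one
    simpa [hX.grid_zero ω] using this
  apply propext
  change (L ω = ℓ ∧ env Y θ 0 ω = v) ↔ (L ω = ℓ ∧ Y 0 ω = v)
  rw [env_eq hω 0 h1 h2]

lemma IsSwitchedFluid.cond_startEvent (hX : IsSwitchedFluid D μ L Y θ) (ℓ : ℤ) (v : E ⊕ S) :
    ProbabilityTheory.cond μ (startEvent L Y θ ℓ v)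
      = ProbabilityTheory.cond μ {ω | L ω = ℓ ∧ Y 0 ω = v} := by
  rw [ProbabilityTheory.cond, ProbabilityTheory.cond, measure_congr (hX.startEvent_ae_eq ℓ v),
    Measure.restrict_congr_set (hX.startEvent_ae_eq ℓ v)]

lemma IsSwitchedFluid.Psi_of_not_compatible (hX : IsSwitchedFluid D μ L Y θ) {ℓ : ℤ} (n : ℕ)
    {i : D.Up} (j : D.Down) (h : ¬ Compatible ℓ (D.upState i)) : Psi D μ L Y θ ℓ n i j = 0 := by
  have h0 : μ {ω | L ω = ℓ ∧ Y 0 ω = D.upState i} = 0 := by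
    refine measure_mono_null (fun ω hω => ?_) (ae_iff.1 hX.compatible)
    simp only [Set.mem_ofPred_eq] at hω ⊢
    rw [hω.1, hω.2]
    exact h
  rw [Psi, Matrix.of_apply, hX.cond_startEvent, cond_eq_zero_of_meas_eq_zero h0]
  simp

lemma IsSwitchedFluid.measurableSet_switch_chain [DiscreteMeasurableSpace E]
    [DiscreteMeasurableSpace S] (hX : IsSwitchedFluid D μ L Y θ) (ℓ : ℤ)
    (v : E ⊕ S) : MeasurableSet {ω | L ω = ℓ ∧ Y 0 ω = v} :=
  (hX.measurable_switch (measurableSet_singleton ℓ)).inter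
    (hX.measurable_chain 0 (measurableSet_singleton_sum v))

lemma IsSwitchedFluid.measureReal_path (hX : IsSwitchedFluid D μ L Y θ) (ℓ : ℤ) (n : ℕ)
    (y : Fin (n + 1) → E ⊕ S) :
    μ.real {ω | L ω = ℓ ∧ ∀ k : Fin (n + 1), Y k ω = y k}
      = μ.real {ω | L ω = ℓ ∧ Y 0 ω = y 0} * pathWeight (fun k => D.step k 0) n ℓ y := by
  -- `Fin.ofNat` extends `y` to all indices by wrapping around; only indices up to `n` are used.
  have h := hX.chain_law ℓ n fun k => y (Fin.ofNat (n + 1) k)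
  have hk : ∀ k : Fin (n + 1), Fin.ofNat (n + 1) (k : ℕ) = k := Fin.ofNat_val_eq_self
  have hset : {ω | L ω = ℓ ∧ ∀ k ≤ n, Y k ω = y (Fin.ofNat (n + 1) k)}
      = {ω | L ω = ℓ ∧ ∀ k : Fin (n + 1), Y k ω = y k} := by
    ext ω
    refine and_congr_right fun _ => ⟨fun h k => ?_, fun h k hkn => ?_⟩
    · rw [h k (Nat.lt_succ_iff.1 k.2), hk]
    · have := h (Fin.ofNat (n + 1) k)
      rwa [Fin.val_ofNat, Nat.mod_eq_of_lt (Nat.lt_succ_iff.2 hkn)] at this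
  rw [hset, Finset.prod_range] at h
  rw [h]
  congr 1
  refine Finset.prod_congr rfl fun k _ => ?_
  rw [step_eq_step_sub]
  have e1 : Fin.ofNat (n + 1) (k : ℕ) = k.castSucc := hk k.castSucc
  have e2 : Fin.ofNat (n + 1) ((k : ℕ) + 1) = k.succ := hk k.succ
  rw [e1, e2]

lemma IsSwitchedFluid.measureReal_firstNeg (hX : IsSwitchedFluid D μ L Y θ) (n : ℕ)
    (c : Fin n → ℝ) :
    μ.real {ω | FirstNeg n 0 fun k => c k * (θ (k + 1) ω - θ k ω)} = pathProb D.γ n c 0 := by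
  have hm : ∀ k, Measurable fun ω => θ (k + 1) ω - θ k ω := fun k =>
    (hX.measurable_grid (k + 1)).sub (hX.measurable_grid k)
  have hind := hX.grid_indep.precomp (g := fun k : Fin n => (k : ℕ)) Fin.val_injective
  have hmap := iIndepFun.map_fun_eq_pi_map
    (f := fun (k : Fin n) ω => θ ((k : ℕ) + 1) ω - θ k ω) (fun k => (hm k).aemeasurable) hind
  simp only [hX.grid_law] at hmap
  have hset : MeasurableSet {t : Fin n → ℝ | FirstNeg n 0 fun k => c k * t k} :=
    (measurableSet_firstNeg n c).preimage (f := fun t : Fin n → ℝ => ((0 : ℝ), t)) (by fun_prop)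
  rw [pathProb, ← hmap, map_measureReal_apply
    (measurable_pi_lambda _ fun k : Fin n => hm k) hset]
  rfl

variable [IsProbabilityMeasure μ] [DiscreteMeasurableSpace E] [DiscreteMeasurableSpace S]

lemma IsSwitchedFluid.measureReal_ruin_path (hX : IsSwitchedFluid D μ L Y θ) (ℓ : ℤ) (n : ℕ)
    (y : Fin (n + 1) → E ⊕ S) :
    μ.real ({ω | L ω = ℓ ∧ ∀ k : Fin (n + 1), Y k ω = y k} ∩
        {ω | FirstNeg (n + 1) 0 fun k => D.rate (y k) * (θ (k + 1) ω - θ k ω)})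
      = μ.real {ω | L ω = ℓ ∧ Y 0 ω = y 0} * (pathWeight (fun k => D.step k 0) n ℓ y
        * pathProb D.γ (n + 1) (fun k => D.rate (y k)) 0) := by
  have h1 : MeasurableSet {t : ℕ → ℝ |
      FirstNeg (n + 1) 0 fun k => D.rate (y k) * (t (k + 1) - t k)} :=
    (measurableSet_firstNeg (n + 1) fun k => D.rate (y k)).preimage
      (f := fun t : ℕ → ℝ => ((0 : ℝ), fun k : Fin (n + 1) => t (k + 1) - t k)) (by fun_prop)
  have h2 : MeasurableSet {p : ℤ × (ℕ → E ⊕ S) | p.1 = ℓ ∧ ∀ k : Fin (n + 1), p.2 k = y k} := by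
    refine (measurable_fst (measurableSet_singleton ℓ)).inter ?_
    have : {p : ℤ × (ℕ → E ⊕ S) | ∀ k : Fin (n + 1), p.2 k = y k}
        = ⋂ k : Fin (n + 1), (fun p : ℤ × (ℕ → E ⊕ S) => p.2 k) ⁻¹' {y k} := by
      ext p; simp
    change MeasurableSet {p : ℤ × (ℕ → E ⊕ S) | ∀ k : Fin (n + 1), p.2 k = y k}
    rw [this]
    exact MeasurableSet.iInter fun k =>
      ((measurable_pi_apply _).comp measurable_snd) (measurableSet_singleton_sum _)
  have h := hX.grid_indep_chain.measure_inter_preimage_eq_mul _ _ h1 h2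
  rw [← mul_assoc, ← hX.measureReal_path, ← hX.measureReal_firstNeg, mul_comm, Set.inter_comm]
  simp only [Measure.real]
  rw [← ENNReal.toReal_mul]
  exact congrArg ENNReal.toReal h

lemma IsSwitchedFluid.measureReal_ruin (hX : IsSwitchedFluid D μ L Y θ) (ℓ : ℤ) (n : ℕ)
    (v w : E ⊕ S) :
    μ.real {ω | (L ω = ℓ ∧ Y 0 ω = v) ∧
        (FirstNeg (n + 1) 0 fun k => D.rate (Y k ω) * (θ (k + 1) ω - θ k ω)) ∧ Y n ω = w}
      = μ.real {ω | L ω = ℓ ∧ Y 0 ω = v} * D.exit n ℓ v w 0 := by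
  classical
  set A : (Fin (n + 1) → E ⊕ S) → Set Ω := fun y =>
    {ω | L ω = ℓ ∧ ∀ k : Fin (n + 1), Y k ω = y k} ∩
      {ω | FirstNeg (n + 1) 0 fun k => D.rate (y k) * (θ (k + 1) ω - θ k ω)} with hA
  -- On the cylinder of a fixed trajectory the rates are deterministic, so ruin becomes an event of
  -- the grid alone, to which independence applies.
  have hset : {ω | (L ω = ℓ ∧ Y 0 ω = v) ∧
        (FirstNeg (n + 1) 0 fun k => D.rate (Y k ω) * (θ (k + 1) ω - θ k ω)) ∧ Y n ω = w}
      = ⋃ y ∈ Finset.univ.filter fun y : Fin (n + 1) → E ⊕ S =>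
          y 0 = v ∧ y (Fin.last n) = w, A y := by
    ext ω
    simp only [Set.mem_iUnion, Finset.mem_filter, Finset.mem_univ, true_and, exists_prop, hA,
      Set.mem_inter_iff, Set.mem_ofPred_eq]
    constructor
    · rintro ⟨⟨h1, h2⟩, h3, h4⟩
      exact ⟨fun k => Y k ω, ⟨h2, h4⟩, ⟨h1, fun _ => rfl⟩, h3⟩
    · rintro ⟨y, ⟨h1, h2⟩, ⟨h3, h4⟩, h5⟩
      refine ⟨⟨h3, (h4 0).trans h1⟩, ?_, (h4 (Fin.last n)).trans h2⟩
      simpa only [h4] using h5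
  have hmeas : ∀ y, MeasurableSet (A y) := by
    intro y
    have h1 : MeasurableSet {ω | L ω = ℓ ∧ ∀ k : Fin (n + 1), Y k ω = y k} := by
      refine (hX.measurable_switch (measurableSet_singleton ℓ)).inter ?_
      change MeasurableSet {ω | ∀ k : Fin (n + 1), Y k ω = y k}
      have : {ω | ∀ k : Fin (n + 1), Y k ω = y k} = ⋂ k : Fin (n + 1), Y k ⁻¹' {y k} := by
        ext p; simp
      rw [this]
      exact MeasurableSet.iInter fun k => hX.measurable_chain k (measurableSet_singleton_sum _)
    refine h1.inter ((measurableSet_firstNeg (n + 1) fun k => D.rate (y k)).preimage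
      (f := fun ω => ((0 : ℝ), fun k : Fin (n + 1) => θ (k + 1) ω - θ k ω)) ?_)
    exact measurable_const.prodMk (measurable_pi_lambda _ fun k =>
      (hX.measurable_grid (k + 1)).sub (hX.measurable_grid k))
  have hdisj : Pairwise (Function.onFun Disjoint A) := by
    intro y y' hy
    refine Set.disjoint_left.2 fun ω h h' => hy ?_
    ext1 k
    exact (h.1.2 k).symm.trans (h'.1.2 k)
  rw [hset, measureReal_biUnion_finset (fun y _ y' _ h => hdisj h) fun y _ => hmeas y,
    Finset.sum_filter, Params.exit,
    ← sum_pathWeight_mul_pathProb (fun k => D.step k 0) D.γ_pos (rate_ne_zero D) n ℓ v w le_rfl,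
    Finset.mul_sum]
  refine Finset.sum_congr rfl fun y _ => ?_
  split_ifs with h
  · rw [hX.measureReal_ruin_path, h.1]
  · rw [mul_zero]

lemma IsSwitchedFluid.Psi_succ_of_ne_zero (hX : IsSwitchedFluid D μ L Y θ) {ℓ : ℤ} (n : ℕ)
    {i : D.Up} (j : D.Down) (h0 : μ (startEvent L Y θ ℓ (D.upState i)) ≠ 0) :
    Psi D μ L Y θ ℓ (n + 1) i j = D.exit n ℓ (D.upState i) (D.downState j) 0 := by
  have hne : μ.real {ω | L ω = ℓ ∧ Y 0 ω = D.upState i} ≠ 0 := by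
    rw [measure_congr (hX.startEvent_ae_eq ℓ (D.upState i))] at h0
    exact (measureReal_ne_zero_iff).2 h0
  have hae : ({ω | L ω = ℓ ∧ Y 0 ω = D.upState i} ∩ {ω | RuinConfirmedAt D Y θ (n + 1) ω ∧
        ∀ᶠ t in 𝓝[<] (θ (n + 1) ω), env Y θ t ω = D.downState j} : Set Ω)
      =ᵐ[μ] {ω | (L ω = ℓ ∧ Y 0 ω = D.upState i) ∧
        (FirstNeg (n + 1) 0 fun k => D.rate (Y k ω) * (θ (k + 1) ω - θ k ω))
          ∧ Y n ω = D.downState j} := by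
    filter_upwards [hX.ae_strictMono] with ω hω
    apply propext
    change ((L ω = ℓ ∧ Y 0 ω = D.upState i) ∧ RuinConfirmedAt D Y θ (n + 1) ω ∧
      ∀ᶠ t in 𝓝[<] (θ (n + 1) ω), env Y θ t ω = D.downState j) ↔ _
    rw [ruinConfirmedAt_iff D hω (hX.grid_zero ω), eventually_env_eq_iff hω]
    rfl
  have hmul := hX.measureReal_ruin ℓ n (D.upState i) (D.downState j)
  rw [← measureReal_congr hae] at hmul
  rw [Psi, Matrix.of_apply, hX.cond_startEvent, Measure.real,
    cond_apply (hX.measurableSet_switch_chain ℓ _), ENNReal.toReal_mul, ENNReal.toReal_inv]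
  change (μ.real _)⁻¹ * μ.real _ = _
  rw [hmul, inv_mul_cancel_left₀ hne]

lemma IsSwitchedFluid.Psi_apply (hX : IsSwitchedFluid D μ L Y θ) (ℓ : ℤ) (n : ℕ) (i : D.Up)
    (h : Compatible ℓ (D.upState i) → μ (startEvent L Y θ ℓ (D.upState i)) ≠ 0) (j : D.Down) :
    Psi D μ L Y θ ℓ n i j = (D.Q ℓ n * D.RM) i j := by
  match n with
  | 0 => simp [Psi_zero, Params.Q]
  | 1 =>
    rw [Params.Q, Matrix.zero_mul, Matrix.zero_apply]
    by_cases hc : Compatible ℓ (D.upState i)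
    · rw [hX.Psi_succ_of_ne_zero 0 j (h hc)]
      -- A single sojourn in an increasing state cannot end below zero.
      exact exitFun_zero_of_pos (rate_upState_pos D i) _ _ _
    · exact hX.Psi_of_not_compatible 1 j hc
  | n + 2 =>
    rw [Q_mul_RM_eq_exit]
    by_cases hc : Compatible ℓ (D.upState i)
    · exact hX.Psi_succ_of_ne_zero (n + 1) j (h hc)
    · rw [hX.Psi_of_not_compatible _ j hc, exit_eq_zero_of_not_compatible D hc]

end Law

end SwitchedFluid

end

theorem theorem4 {E S Ω : Type*} [Fintype E] [Fintype S] [DecidableEq E] [DecidableEq S]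
    [MeasurableSpace E] [DiscreteMeasurableSpace E] [MeasurableSpace S]
    [DiscreteMeasurableSpace S] [MeasurableSpace Ω]
    (D : SwitchedFluid.Params E S) (μ : Measure Ω) [IsProbabilityMeasure μ]
    (L : Ω → ℤ) (Y : ℕ → Ω → E ⊕ S) (θ : ℕ → Ω → ℝ)
    (hX : SwitchedFluid.IsSwitchedFluid D μ L Y θ) :
    -- the first return probability matrix, row by row and as a matrix
    (∀ (ℓ : ℤ) (n : ℕ) (i : D.Up),
      (SwitchedFluid.Compatible ℓ (D.upState i) →
        μ (SwitchedFluid.startEvent L Y θ ℓ (D.upState i)) ≠ 0) →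
      ∀ j : D.Down, SwitchedFluid.Psi D μ L Y θ ℓ n i j = (D.Q ℓ n * D.RM) i j) ∧
    (∀ (ℓ : ℤ) (n : ℕ),
      (∀ i : D.Up, SwitchedFluid.Compatible ℓ (D.upState i) →
        μ (SwitchedFluid.startEvent L Y θ ℓ (D.upState i)) ≠ 0) →
      SwitchedFluid.Psi D μ L Y θ ℓ n = D.Q ℓ n * D.RM) ∧
    -- the recursion for `Q`
    (∀ ℓ : ℤ, D.Q ℓ 2 = D.BPM ℓ ⊙ D.H) ∧
    (∀ (ℓ : ℤ) (n : ℕ), 3 ≤ n →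
      D.Q ℓ n =
        (D.BPP ℓ * D.Q (ℓ - 1) (n - 1) * D.RM) ⊙ D.H
        + ∑ w ∈ Finset.Icc 2 (n - 2),
            (D.RP * D.Q ℓ w * D.BMP ℓ w * D.Q (ℓ - (w : ℤ)) (n - w) * D.RM) ⊙ D.H
        + (D.RP * D.Q ℓ (n - 1) * D.BMM ℓ n) ⊙ D.H) := by
  exact ⟨fun ℓ n i h j => hX.Psi_apply ℓ n i h j,
    fun ℓ n h => Matrix.ext fun i j => hX.Psi_apply ℓ n i (h i) j,
    fun ℓ => by rw [SwitchedFluid.Params.Q],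
    fun ℓ n hn => SwitchedFluid.Q_eq D ℓ hn⟩
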